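/- Setting. For a total order $O$, a nonempty interval is $[\ell..r]$ with $\ell\le r$ in $O$; intervals are ordered by inclusion. An input with $m\ge 1$ lists is an array $I=(A_0,\dots,A_{m-1})$ of nonempty finite antichains of nonempty intervals of a total order $O$, each given as the list of its intervals in increasing order of left (equivalently, right) extremes. A (deterministic) algorithm accesses the $i$-th list only by a function next, which returns the next interval of $A_i$ and null when the list is exhausted; it emits a list of intervals, one at a time, and then null. The order $O$ is unknown to the algorithm: it can only compare the extremes it has read, so it works in the same way for all $O$ and commutes with all order embeddings. Let $\rho_i^{\mathscr A}(I,p)$ be the number of elements (possibly including null) that $\mathscr A$ has read from the $i$-th list of $I$ when it emits its $p$-th output; here $p\ge1$ and the output on $I$ has at least $p$ intervals. Two algorithms are functionally equivalent if they produce the same output list on every input. An algorithm $\mathscr A$ is - minimally lazy if every functionally equivalent $\mathscr B$ with $\rho_i^{\mathscr B}(I,p)\le\rho_i^{\mathscr A}(I,p)$ for all $I,i,p$ satisfies $\rho_i^{\mathscr B}(I,p)=\rho_i^{\mathscr A}(I,p)$ for all $I,i,p$; - $k$-lazy ($k\in\mathbb Z$) if $\rho_i^{\mathscr A}(I,p)\le\rho_i^{\mathscr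 B}(I,p)+k$ for every functionally equivalent $\mathscr B$ and all $I,i,p$; - optimally lazy if, for some $k$, it is $k$-lazy and no functionally equivalent algorithm is $(k-1)$-lazy. The algorithm. The operator AND maps $A_0,\dots,A_{m-1}$ to the set of minimal intervals among those spanned by the tuples of $A_0\times\cdots\times A_{m-1}$. It is computed by the following algorithm. A priority queue $Q$ holds a set of indices in $\{0,\dots,m-1\}$, each referring to the last interval read from the corresponding list; the top is the least interval for the order $[\ell..r]\preceq[\ell'..r']\iff \ell<\ell'$ or ($\ell=\ell'$ and $r\ge r'$), and the top index is an index that refers to it, chosen among the possible ones by an arbitrary fixed rule, which may depend on the whole history of the computation through comparisons of extremes. $Q$ is full if it contains all $m$ indices; span$(Q)$ is the least interval containing all intervals in $Q$; advance$(Q)$ reads the next interval of the list of the top index $i$, and removes $i$ from $Q$ if null is read. Initially one interval is read from each list and $c=[-\infty..-\infty]$ (which is contained in no interval of $O$). Each output is computed thus: while $Q$ is full and $c\subseteq$ span$(Q)$, advance$(Q)$; if $Q$ is not full, return null; then repeat [$c\leftarrow$ span$(Q)$; if $c$ is the top interval, return $c$; advance$(Q)$] as long as, after that, $Q$ is full and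 span$(Q)\subseteq c$; return $c$. Theorem. For every $m\ge1$ and every rule for choosing the top index among ties, this algorithm is minimally lazy and optimally lazy. It is $1$-lazy. If $m\ge 3$, no functionally equivalent algorithm is $0$-lazy. -/

import Mathlib

/-! Lazy algorithms on lists of intervals, and the indirect-queue algorithm for the operator AND.

A nonempty interval `[ℓ..r]` of a total order `O` is a Mathlib `NonemptyInterval O` (with extremes
`x.fst = ℓ ≤ r = x.snd`), ordered by containment. In
`WithBot (NonemptyInterval O)` the element `⊥` is the empty interval. -/

namespace LazyAnd

/-- The image of an interval under an order embedding of the ground order. -/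
def mapInterval {O P : Type} [LinearOrder O] [LinearOrder P] (f : O ↪o P)
    (x : NonemptyInterval O) : NonemptyInterval P :=
  x.map f.toOrderHom

/-! ### Algorithms reading an array of lists -/

/-- What happens in one step of a computation: either `next` is called on the `i`-th input list and
returns `x` (`none` is null), or an interval is returned as the next output. -/
inductive Event (m : ℕ) (O : Type) [LinearOrder O] where
  | read (i : Fin m) (x : Option (NonemptyInterval O))
  | emit (c : NonemptyInterval O)

/-- What an algorithm decides to do next: call `next` on the `i`-th input list, return an interval
as the next output, or return null, which ends the output. -/
inductive Action (m : ℕ) (O : Type) [LinearOrder O] where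
  | read (i : Fin m)
  | emit (c : NonemptyInterval O)
  | halt

/-- Transport of an event along an order embedding. -/
def Event.map {m : ℕ} {O P : Type} [LinearOrder O] [LinearOrder P] (f : O ↪o P) :
    Event m O → Event m P
  | .read i x => .read i (x.map (mapInterval f))
  | .emit c => .emit (mapInterval f c)

/-- Transport of an action along an order embedding. -/
def Action.map {m : ℕ} {O P : Type} [LinearOrder O] [LinearOrder P] (f : O ↪o P) :
    Action m O → Action m P
  | .read i => .read i
  | .emit c => .emit (mapInterval f c)
  | .halt => .halt

/-- A (deterministic) algorithm with `m` input lists: a rule that chooses the next action from the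
history of the computation so far (in chronological order). The ground order is unknown to the
algorithm, which can only compare the extremes that it has read: the rule is the same for
all total orders, that is, it commutes with all order embeddings. -/
structure Algorithm (m : ℕ) where
  act : ∀ {O : Type} [LinearOrder O], List (Event m O) → Action m O
  act_map : ∀ {O P : Type} [LinearOrder O] [LinearOrder P] (f : O ↪o P) (h : List (Event m O)),
    act (h.map (Event.map f)) = (act h).map f

/-- An input: an array of `m` nonempty finite antichains of nonempty intervals, each given as the
list of its intervals in their natural order. -/
structure Input (m : ℕ) (O : Type) [LinearOrder O] where
  list : Fin m → List (NonemptyInterval O)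
  nonempty : ∀ i, list i ≠ []
  antichain : ∀ i, IsAntichain (· ≤ ·) {x | x ∈ list i}
  sorted : ∀ i, (list i).Pairwise (fun x y => x.fst < y.fst)

section History

variable {m : ℕ} {O : Type} [LinearOrder O]

/-- The number of elements (possibly including null) read from the `i`-th list in a history. -/
def reads (i : Fin m) : List (Event m O) → ℕ
  | [] => 0
  | .read j _ :: h => reads i h + if j = i then 1 else 0
  | .emit _ :: h => reads i h

/-- The outputs returned in a history. -/
def outputs : List (Event m O) → List (NonemptyInterval O)
  | [] => []
  | .read _ _ :: h => outputs h
  | .emit c :: h => c :: outputs h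

/-- The history of the computation of `A` on input `I` after `n` steps (or up to the moment in
which `A` halts). -/
def Algorithm.history (A : Algorithm m) (I : Input m O) : ℕ → List (Event m O)
  | 0 => []
  | n + 1 =>
    let h := A.history I n
    match A.act h with
    | .read i => h ++ [.read i (I.list i)[reads i h]?]
    | .emit c => h ++ [.emit c]
    | .halt => h

/-- On input `I` the algorithm `A` returns the intervals of `L`, in this order, and then null. -/
def Algorithm.HasOutput (A : Algorithm m) (I : Input m O) (L : List (NonemptyInterval O)) : Prop :=
  ∃ n, A.act (A.history I n) = .halt ∧ outputs (A.history I n) = L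

/-- `ρ_i^A(I, p)`: the number of elements (possibly including null) read by `A` from the `i`-th list
of `I` when the `p`-th output is produced. -/
noncomputable def Algorithm.rho (A : Algorithm m) (I : Input m O) (i : Fin m) (p : ℕ) : ℕ :=
  reads i (A.history I (sInf {n | p ≤ (outputs (A.history I n)).length}))

/-- The output of `A` on `I` contains a `p`-th interval (counting from one). -/
def Algorithm.HasNthOutput (A : Algorithm m) (I : Input m O) (p : ℕ) : Prop :=
  1 ≤ p ∧ ∃ L, A.HasOutput I L ∧ p ≤ L.length

end History

/-! ### Laziness -/

section Laziness

variable {m : ℕ}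

/-- Two algorithms are functionally equivalent if they produce the same output list when they are
given the same input lists. -/
def FunctionallyEquivalent (A B : Algorithm m) : Prop :=
  ∀ (O : Type) [LinearOrder O] (I : Input m O) (L : List (NonemptyInterval O)),
    A.HasOutput I L ↔ B.HasOutput I L

def MinimallyLazy (A : Algorithm m) : Prop :=
  ∀ B : Algorithm m, FunctionallyEquivalent A B →
    (∀ (O : Type) [LinearOrder O] (I : Input m O) (i : Fin m) (p : ℕ),
      A.HasNthOutput I p → B.rho I i p ≤ A.rho I i p) →
    ∀ (O : Type) [LinearOrder O] (I : Input m O) (i : Fin m) (p : ℕ),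
      A.HasNthOutput I p → B.rho I i p = A.rho I i p

def IsLazy (k : ℤ) (A : Algorithm m) : Prop :=
  ∀ B : Algorithm m, FunctionallyEquivalent A B →
    ∀ (O : Type) [LinearOrder O] (I : Input m O) (i : Fin m) (p : ℕ),
      A.HasNthOutput I p → (A.rho I i p : ℤ) ≤ B.rho I i p + k

def OptimallyLazy (A : Algorithm m) : Prop :=
  ∃ k : ℤ, IsLazy k A ∧ ¬ ∃ B : Algorithm m, FunctionallyEquivalent A B ∧ IsLazy (k - 1) B

end Laziness

/-! ### The algorithm for AND -/

/-- The priority order `⪯`: `[ℓ..r] ⪯ [ℓ'..r']` iff `ℓ < ℓ'`, or `ℓ = ℓ'` and `r ≥ r'`. -/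
def Prec {O : Type} [LinearOrder O] (x y : NonemptyInterval O) : Prop :=
  x.fst < y.fst ∨ x.fst = y.fst ∧ y.snd ≤ x.snd

instance {O : Type} [LinearOrder O] (x y : NonemptyInterval O) : Decidable (Prec x y) := by
  unfold Prec; infer_instance

/-- The way in which an implementation of the priority queue chooses the top index when several
indices refer to the least item: it may depend on everything that happened before, but, as the rest
of the algorithm, only by comparing extremes. -/
structure TieRule (m : ℕ) where
  choose : ∀ {O : Type} [LinearOrder O], List (Event m O) → Finset (Fin m) → Fin m
  choose_mem : ∀ {O : Type} [LinearOrder O] (h : List (Event m O)) (S : Finset (Fin m)),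
    S.Nonempty → choose h S ∈ S
  choose_map : ∀ {O P : Type} [LinearOrder O] [LinearOrder P] (f : O ↪o P)
    (h : List (Event m O)) (S : Finset (Fin m)),
    choose (h.map (Event.map f)) S = choose h S

/-- The two points of the function `next` at which a computation can be resumed: the condition of
the first while loop (which is also the entry point) and the condition of the second one. -/
inductive Loop where
  | first
  | second

/-- The state of the algorithm: the reference array (`none` for the indices that are not in the
queue), the last interval `c` (`none` is `[-∞..-∞]`), and the point at which to resume. -/
structure State (m : ℕ) (O : Type) [LinearOrder O] where
  ref : Fin m → Option (NonemptyInterval O)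
  c : Option (NonemptyInterval O)
  loop : Loop

/-- What the function `next` does when it stops: it executes `advance(Q)`, or it returns an
interval or null. -/
inductive Move (O : Type) [LinearOrder O] where
  | advance
  | ret (c : NonemptyInterval O)
  | retNull

namespace State

variable {m : ℕ} {O : Type} [LinearOrder O]

/-- The queue is full, that is, it contains all `m` indices. -/
def Full (s : State m O) : Prop := ∀ i, (s.ref i).isSome = true

instance (s : State m O) : Decidable s.Full := by
  unfold Full; infer_instance

/-- `x` is the top item of the queue and `i` is an index referring to it. -/
def IsTop (s : State m O) (i : Fin m) (x : NonemptyInterval O) : Prop :=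
  s.ref i = some x ∧ ∀ j, ∀ y ∈ s.ref j, Prec x y

instance (s : State m O) (i : Fin m) (x : NonemptyInterval O) : Decidable (s.IsTop i x) := by
  unfold IsTop; infer_instance

/-- The indices that refer to the top item. -/
def topIndices (s : State m O) : Finset (Fin m) :=
  Finset.univ.filter fun i => ∃ x ∈ s.ref i, s.IsTop i x

/-- The interval spanned by the queue, that is, the least interval containing all intervals
currently in the queue: it goes from the left extreme of the top item to the largest right
extreme. It is used only when the queue is full. -/
def span (s : State m O) : WithBot (NonemptyInterval O) :=
  Finset.univ.sup fun i => (s.ref i).elim ⊥ fun x => (x : WithBot (NonemptyInterval O))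

/-- The condition `c ⊆ span(Q)` (false when `c = [-∞..-∞]`). -/
def CLeSpan (s : State m O) : Prop := ∃ x ∈ s.c, (x : WithBot (NonemptyInterval O)) ≤ s.span

instance (s : State m O) : Decidable s.CLeSpan := by
  unfold CLeSpan; infer_instance

/-- The condition `span(Q) ⊆ c`. -/
def SpanLeC (s : State m O) : Prop := ∃ x ∈ s.c, s.span ≤ (x : WithBot (NonemptyInterval O))

instance (s : State m O) : Decidable s.SpanLeC := by
  unfold SpanLeC; infer_instance

/-- The body of the second while loop: `c ← span(Q); if c = top(Q) then return c; advance(Q)`.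
After a return, the next call starts from the first loop. -/
def body (s : State m O) : State m O × Move O :=
  match s.span with
  | ⊥ => (s, .retNull)
  | (x : NonemptyInterval O) =>
    if ∃ i, s.IsTop i x then ({ s with c := some x, loop := .first }, .ret x)
    else ({ s with c := some x, loop := .second }, .advance)

/-- The computation performed by the function `next` up to the next `advance` or `return`:

    while Q is full and c ⊆ span(Q) do advance(Q);
    if Q is not full then return null;
    do c ← span(Q); if c = top(Q) then return c; advance(Q) while Q is full and span(Q) ⊆ c;
    return c

(the branch `none` in the last case is never reached, as `c` has been assigned). -/
def control (s : State m O) : State m O × Move O :=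
  match s.loop with
  | .first =>
    if s.Full ∧ s.CLeSpan then (s, .advance)
    else if s.Full then s.body
    else (s, .retNull)
  | .second =>
    if s.Full ∧ s.SpanLeC then s.body
    else match s.c with
      | some x => ({ s with loop := .first }, .ret x)
      | none => (s, .retNull)

/-- The effect of an event on the queue: an interval read from the `i`-th list becomes the item of
index `i`; if null is read, `i` is dequeued. -/
def receive (s : State m O) : Event m O → State m O
  | .read i x => { s with ref := Function.update s.ref i x }
  | .emit _ => s

/-- The state after the initial phase, in which the first `m` events read the first element of each
list, starting from `c = [-∞..-∞]`. -/
def initial (h : List (Event m O)) : State m O :=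
  (h.take m).foldl receive { ref := fun _ => none, c := none, loop := .first }

/-- The state of the algorithm after a history. -/
def after (h : List (Event m O)) : State m O :=
  (h.drop m).foldl (fun s e => s.control.1.receive e) (initial h)

end State

/-- The next action of the algorithm for AND: first, read one element from each list; then, execute
the function `next` repeatedly. Executing `advance(Q)` means reading the next element of the list
associated with the top index. -/
def andAct {m : ℕ} (tie : TieRule m) {O : Type} [LinearOrder O] (h : List (Event m O)) :
    Action m O :=
  if hlt : h.length < m then .read ⟨h.length, hlt⟩
  else match (State.after h).control.2 with
    | .advance => .read (tie.choose h (State.after h).topIndices)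
    | .ret c => .emit c
    | .retNull => .halt

/-! The algorithm for AND only compares extremes. -/

section Naturality

variable {m : ℕ} {O P : Type} [LinearOrder O] [LinearOrder P] (f : O ↪o P)

theorem mapInterval_le {x y : NonemptyInterval O} :
    mapInterval f x ≤ mapInterval f y ↔ x ≤ y := by
  simp [mapInterval, NonemptyInterval.map, NonemptyInterval.le_def]

theorem mapInterval_injective : Function.Injective (mapInterval f) := by
  intro x y h
  exact le_antisymm ((mapInterval_le f).1 h.le) ((mapInterval_le f).1 h.ge)

theorem prec_map {x y : NonemptyInterval O} :
    Prec (mapInterval f x) (mapInterval f y) ↔ Prec x y := by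
  simp [Prec, mapInterval, NonemptyInterval.map]

def State.map (s : State m O) : State m P :=
  { ref := fun i => (s.ref i).map (mapInterval f), c := s.c.map (mapInterval f), loop := s.loop }

def Move.map : Move O → Move P
  | .advance => .advance
  | .ret c => .ret (mapInterval f c)
  | .retNull => .retNull

theorem full_map (s : State m O) : (s.map f).Full ↔ s.Full := by
  simp [State.Full, State.map]

theorem isTop_map (s : State m O) (i : Fin m) (x : NonemptyInterval O) :
    (s.map f).IsTop i (mapInterval f x) ↔ s.IsTop i x := by
  simp only [State.IsTop, State.map, Option.map_eq_some_iff, Option.mem_def]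
  constructor
  · rintro ⟨⟨a, ha, hax⟩, h⟩
    obtain rfl := mapInterval_injective f hax
    exact ⟨ha, fun j y hy => (prec_map f).1 (h j _ ⟨y, hy, rfl⟩)⟩
  · rintro ⟨ha, h⟩
    refine ⟨⟨x, ha, rfl⟩, ?_⟩
    rintro j y ⟨z, hz, rfl⟩
    exact (prec_map f).2 (h j z hz)

theorem topIndices_map (s : State m O) : (s.map f).topIndices = s.topIndices := by
  ext i
  simp only [State.topIndices, Finset.mem_filter, Finset.mem_univ, true_and]
  constructor
  · rintro ⟨x, hx, h⟩
    simp only [State.map, Option.mem_def, Option.map_eq_some_iff] at hx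
    obtain ⟨y, hy, rfl⟩ := hx
    exact ⟨y, hy, (isTop_map f s i y).1 h⟩
  · rintro ⟨x, hx, h⟩
    refine ⟨mapInterval f x, ?_, (isTop_map f s i x).2 h⟩
    simp only [Option.mem_def] at hx
    simp [State.map, hx]

theorem mapInterval_sup (x y : NonemptyInterval O) :
    mapInterval f (x ⊔ y) = mapInterval f x ⊔ mapInterval f y := by
  apply NonemptyInterval.ext
  apply Prod.ext
  · exact f.monotone.map_inf _ _
  · exact f.monotone.map_sup _ _

theorem span_map (s : State m O) : (s.map f).span = WithBot.map (mapInterval f) s.span := by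
  have hsup : ∀ x y : WithBot (NonemptyInterval O), WithBot.map (mapInterval f) (x ⊔ y) =
      WithBot.map (mapInterval f) x ⊔ WithBot.map (mapInterval f) y := by
    intro x y
    induction x using WithBot.recBotCoe with
    | bot => simp
    | coe x =>
      induction y using WithBot.recBotCoe with
      | bot => simp
      | coe y =>
        rw [← WithBot.coe_sup, WithBot.map_coe, mapInterval_sup, WithBot.coe_sup, WithBot.map_coe,
          WithBot.map_coe]
  unfold State.span
  rw [Finset.apply_sup_eq_sup_comp _ hsup (WithBot.map_bot _)]
  congr 1
  funext i
  cases hi : s.ref i <;> simp [State.map, hi]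

theorem withBot_map_le (x y : WithBot (NonemptyInterval O)) :
    WithBot.map (mapInterval f) x ≤ WithBot.map (mapInterval f) y ↔ x ≤ y :=
  WithBot.map_le_iff _ (mapInterval_le f)

theorem cLeSpan_map (s : State m O) : (s.map f).CLeSpan ↔ s.CLeSpan := by
  unfold State.CLeSpan
  rw [span_map]
  cases hc : s.c with
  | none => simp [State.map, hc]
  | some x =>
    simp only [State.map, hc, Option.map_some, Option.mem_def, Option.some.injEq, exists_eq_left']
    exact withBot_map_le f (x : WithBot (NonemptyInterval O)) s.span

theorem spanLeC_map (s : State m O) : (s.map f).SpanLeC ↔ s.SpanLeC := by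
  unfold State.SpanLeC
  rw [span_map]
  cases hc : s.c with
  | none => simp [State.map, hc]
  | some x =>
    simp only [State.map, hc, Option.map_some, Option.mem_def, Option.some.injEq, exists_eq_left']
    exact withBot_map_le f s.span (x : WithBot (NonemptyInterval O))

theorem body_map (s : State m O) : (s.map f).body = (s.body.1.map f, s.body.2.map f) := by
  have h := span_map f s
  unfold State.body
  rw [h]
  generalize s.span = x
  cases x with
  | bot => rfl
  | coe x =>
    simp only [WithBot.map_coe, isTop_map]
    by_cases ht : ∃ i, s.IsTop i x
    · simp only [ht, if_true]; rfl
    · simp only [ht, if_false]; rfl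

theorem control_map (s : State m O) :
    (s.map f).control = (s.control.1.map f, s.control.2.map f) := by
  unfold State.control
  simp only [full_map, cLeSpan_map, spanLeC_map, body_map]
  have hl : (s.map f).loop = s.loop := rfl
  rw [hl]
  cases s.loop with
  | first =>
    simp only
    split_ifs <;> rfl
  | second =>
    simp only
    split_ifs
    · rfl
    · cases hc : s.c with
      | none => simp [State.map, hc, Move.map]
      | some x => simp [State.map, hc, Move.map]

theorem receive_map (s : State m O) (e : Event m O) :
    (s.map f).receive (e.map f) = (s.receive e).map f := by
  cases e with
  | read i x =>
    simp only [State.receive, Event.map, State.map, State.mk.injEq, and_true]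
    funext j
    by_cases h : j = i <;> simp [h]
  | emit c => rfl

theorem after_map (h : List (Event m O)) :
    State.after (h.map (Event.map f)) = (State.after h).map f := by
  have h1 : ∀ (l : List (Event m O)) (s : State m O),
      (l.map (Event.map f)).foldl State.receive (s.map f) = (l.foldl State.receive s).map f := by
    intro l
    induction l with
    | nil => intro s; rfl
    | cons e l ih => intro s; simp only [List.map_cons, List.foldl_cons, receive_map, ih]
  have h2 : ∀ (l : List (Event m O)) (s : State m O),
      (l.map (Event.map f)).foldl (fun s e => s.control.1.receive e) (s.map f) =
        (l.foldl (fun s e => s.control.1.receive e) s).map f := by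
    intro l
    induction l with
    | nil => intro s; rfl
    | cons e l ih =>
      intro s
      simp only [List.map_cons, List.foldl_cons, control_map, receive_map, ih]
  unfold State.after State.initial
  rw [← h2, ← h1, ← List.map_take, ← List.map_drop]
  rfl

theorem andAct_map (tie : TieRule m) (h : List (Event m O)) :
    andAct tie (h.map (Event.map f)) = (andAct tie h).map f := by
  unfold andAct
  by_cases hlt : h.length < m
  · simp [hlt, Action.map]
  · simp only [List.length_map, hlt, dite_false, after_map, control_map, topIndices_map,
      tie.choose_map]
    cases (State.after h).control.2 <;> rfl

end Naturality

/-- The indirect-priority-queue algorithm for AND, for a given way of breaking ties. -/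
def andAlgorithm {m : ℕ} (tie : TieRule m) : Algorithm m where
  act := andAct tie
  act_map := fun f h => andAct_map f tie h

end LazyAnd

/-! The output of AND consists of the minimal intervals that contain an element of every list, in
increasing order of left extreme. Correctness of the queue rests on an invariant, `Inv`: the outputs
so far are all the minimal intervals up to a threshold on the left extreme, and no element already
replaced in the queue starts beyond the threshold. `Inv.outcome` analyses one execution of
`control`, and `inv_history` carries the invariant along a run.

Lower bounds for an equivalent algorithm `B` come from an adversary argument: `B` cannot distinguish
inputs that agree on what it has read, even after the order is embedded in a larger one
(`history_map_of_agree`). Altering the unread part shows that, before returning `c`, `B` has read an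
interval contained in `c` from each list (`exists_read_le`). If `c` is in no list, `B` has also
read, from some list, an element that starts with `c` together with its successor, which sticks out
of `c` or is null (`exists_read_successor`).

The queue is 1-lazy because the elements it has passed do not start after `c`, so that it goes at
most one element beyond what the first bound imposes. If `B` never reads more than the queue and
somewhere reads less, then on a truncated input the queue finds null and returns `c` at once,
without the successor that `B` has read from another list; hence minimal laziness. Optimality is
then formal: a 0-lazy equivalent of a minimally lazy algorithm has the same reads. With three lists,
two tie rules can be made to advance different lists on the same input, and neither is 0-lazy. -/

namespace LazyAnd

/-! ### Histories -/

section Histories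

variable {m : ℕ} {O P : Type} [LinearOrder O] [LinearOrder P]

theorem reads_append (i : Fin m) (h h' : List (Event m O)) :
    reads i (h ++ h') = reads i h + reads i h' := by
  induction h with
  | nil => simp [reads]
  | cons e h ih => cases e <;> simp [reads, ih]; omega

theorem outputs_append (h h' : List (Event m O)) :
    outputs (h ++ h') = outputs h ++ outputs h' := by
  induction h with
  | nil => simp [outputs]
  | cons e h ih => cases e <;> simp [outputs, ih]

theorem reads_map (f : O ↪o P) (i : Fin m) (h : List (Event m O)) :
    reads i (h.map (Event.map f)) = reads i h := by
  induction h with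
  | nil => rfl
  | cons e h ih => cases e <;> simp [reads, Event.map, ih]

theorem length_eq_sum_reads_add_outputs (h : List (Event m O)) :
    h.length = ∑ i, reads i h + (outputs h).length := by
  induction h with
  | nil => simp [reads, outputs]
  | cons e h ih =>
    cases e with
    | read j x => simp [reads, outputs, ih, Finset.sum_add_distrib]; omega
    | emit c => simp [reads, outputs, ih]; omega

namespace Algorithm

variable {A : Algorithm m} {I : Input m O}

theorem history_succ_of_read {n : ℕ} {i : Fin m} (h : A.act (A.history I n) = .read i) :
    A.history I (n + 1) = A.history I n ++ [.read i (I.list i)[reads i (A.history I n)]?] := by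
  simp only [history, h]

theorem history_succ_of_emit {n : ℕ} {c : NonemptyInterval O}
    (h : A.act (A.history I n) = .emit c) :
    A.history I (n + 1) = A.history I n ++ [.emit c] := by
  simp only [history, h]

theorem history_succ_of_halt {n : ℕ} (h : A.act (A.history I n) = .halt) :
    A.history I (n + 1) = A.history I n := by
  simp only [history, h]

theorem history_prefix (A : Algorithm m) (I : Input m O) {n n' : ℕ} (h : n ≤ n') :
    A.history I n <+: A.history I n' := by
  induction n', h using Nat.le_induction with
  | base => exact List.prefix_rfl
  | succ k _ ih =>
    refine ih.trans ?_
    cases hk : A.act (A.history I k) with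
    | read i => rw [history_succ_of_read hk]; exact List.prefix_append _ _
    | emit c => rw [history_succ_of_emit hk]; exact List.prefix_append _ _
    | halt => rw [history_succ_of_halt hk]

theorem reads_mono (A : Algorithm m) (I : Input m O) (i : Fin m) {n n' : ℕ} (h : n ≤ n') :
    reads i (A.history I n) ≤ reads i (A.history I n') := by
  obtain ⟨t, ht⟩ := A.history_prefix I h
  rw [← ht, reads_append]
  omega

theorem outputs_prefix (A : Algorithm m) (I : Input m O) {n n' : ℕ} (h : n ≤ n') :
    outputs (A.history I n) <+: outputs (A.history I n') := by
  obtain ⟨t, ht⟩ := A.history_prefix I h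
  rw [← ht, outputs_append]
  exact List.prefix_append _ _

theorem history_of_halt {n n' : ℕ} (h : A.act (A.history I n) = .halt) (hn : n ≤ n') :
    A.history I n' = A.history I n := by
  induction n', hn using Nat.le_induction with
  | base => rfl
  | succ k _ ih => rw [history_succ_of_halt (by rw [ih, h]), ih]

theorem HasOutput.prefix {L : List (NonemptyInterval O)} (h : A.HasOutput I L) (n : ℕ) :
    outputs (A.history I n) <+: L := by
  obtain ⟨k, hk, rfl⟩ := h
  rcases le_total n k with hn | hn
  · exact A.outputs_prefix I hn
  · rw [history_of_halt hk hn]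

theorem HasOutput.unique {L L' : List (NonemptyInterval O)} (h : A.HasOutput I L)
    (h' : A.HasOutput I L') : L = L' := by
  obtain ⟨k, hk, rfl⟩ := h'
  obtain ⟨k', hk', rfl⟩ := h
  rcases le_total k k' with hn | hn
  · rw [history_of_halt hk hn]
  · rw [history_of_halt hk' hn]

/-- The number of reads grows by at most one per step, so it takes the value `q` just before element
`q` is read. -/
theorem exists_read {n q : ℕ} {i : Fin m} (h : q < reads i (A.history I n)) :
    ∃ k < n, reads i (A.history I k) = q ∧ A.act (A.history I k) = .read i := by
  induction n with
  | zero => simp [history, reads] at h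
  | succ n ih =>
    by_cases hq : q < reads i (A.history I n)
    · obtain ⟨k, hk, h1, h2⟩ := ih hq
      exact ⟨k, by omega, h1, h2⟩
    · cases hn : A.act (A.history I n) with
      | read j =>
        rw [history_succ_of_read hn, reads_append] at h
        by_cases hj : j = i
        · subst hj
          simp only [reads, if_true] at h
          exact ⟨n, by omega, by omega, hn⟩
        · simp only [reads, hj, if_false] at h
          omega
      | emit c =>
        rw [history_succ_of_emit hn, reads_append] at h
        simp only [reads] at h
        omega
      | halt => rw [history_succ_of_halt hn] at h; omega

/-- The reads at the `p`-th output can be computed at any step that returns the `p`-th output. -/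
theorem rho_of_emit {n p : ℕ} {c : NonemptyInterval O} (h : A.act (A.history I n) = .emit c)
    (hp : (outputs (A.history I n)).length + 1 = p) (i : Fin m) :
    A.rho I i p = reads i (A.history I n) := by
  have h0 : sInf {n | p ≤ (outputs (A.history I n)).length} = n + 1 := by
    apply le_antisymm
    · apply Nat.sInf_le
      simp only [Set.mem_ofPred_eq]
      rw [history_succ_of_emit h, outputs_append]
      simp [outputs, hp]
    · refine le_csInf ⟨n + 1, ?_⟩ fun k hk => ?_
      · simp only [Set.mem_ofPred_eq]
        rw [history_succ_of_emit h, outputs_append]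
        simp [outputs, hp]
      · by_contra hlt
        have := (A.outputs_prefix I (show k ≤ n by omega)).length_le
        simp only [Set.mem_ofPred_eq] at hk
        omega
  rw [rho, h0, history_succ_of_emit h, reads_append]
  simp [reads]

theorem HasNthOutput.exists_emit {p : ℕ} (h : A.HasNthOutput I p) :
    ∃ n c, A.act (A.history I n) = .emit c ∧ (outputs (A.history I n)).length + 1 = p := by
  obtain ⟨hp, L, ⟨k, -, rfl⟩, hL⟩ := h
  induction k with
  | zero => simp [history, outputs] at hL; omega
  | succ n ih =>
    by_cases hn : p ≤ (outputs (A.history I n)).length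
    · exact ih hn
    · cases ha : A.act (A.history I n) with
      | read j =>
        rw [history_succ_of_read ha, outputs_append] at hL
        simp [outputs] at hL
        omega
      | emit c =>
        rw [history_succ_of_emit ha, outputs_append] at hL
        simp [outputs] at hL
        exact ⟨n, c, ha, by omega⟩
      | halt => rw [history_succ_of_halt ha] at hL; omega

theorem HasOutput.getElem?_of_emit {L : List (NonemptyInterval O)} (hL : A.HasOutput I L)
    {n : ℕ} {c : NonemptyInterval O} (h : A.act (A.history I n) = .emit c) :
    L[(outputs (A.history I n)).length]? = some c := by
  obtain ⟨t, ht⟩ := hL.prefix (n + 1)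
  rw [history_succ_of_emit h, outputs_append] at ht
  simp [← ht, outputs]

/-- Two inputs that agree on what an algorithm reads are indistinguishable to it. -/
theorem history_map_of_agree (B : Algorithm m) (f : O ↪o P) (I : Input m O) (J : Input m P)
    (n : ℕ) (h : ∀ i k, k < reads i (B.history I n) →
      (J.list i)[k]? = ((I.list i)[k]?).map (mapInterval f)) :
    B.history J n = (B.history I n).map (Event.map f) := by
  induction n with
  | zero => rfl
  | succ n ih =>
    have ih := ih fun i k hk => h i k (hk.trans_le (B.reads_mono I i n.le_succ))
    have hact : B.act (B.history J n) = (B.act (B.history I n)).map f := by rw [ih, B.act_map]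
    cases ha : B.act (B.history I n) with
    | read i =>
      rw [ha] at hact
      have hr : reads i (B.history I n) < reads i (B.history I (n + 1)) := by
        rw [history_succ_of_read ha, reads_append]
        simp [reads]
      rw [history_succ_of_read ha, history_succ_of_read hact, List.map_append, ih, reads_map,
        h i _ hr]
      rfl
    | emit c =>
      rw [ha] at hact
      rw [history_succ_of_emit ha, history_succ_of_emit hact, List.map_append, ih]
      rfl
    | halt =>
      rw [ha] at hact
      rw [history_succ_of_halt ha, history_succ_of_halt hact, ih]

end Algorithm

theorem Event.map_refl (e : Event m O) : e.map (RelEmbedding.refl (· ≤ ·)) = e := by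
  cases e with
  | read i x => cases x <;> rfl
  | emit c => rfl

theorem Algorithm.history_eq_of_agree (B : Algorithm m) (I J : Input m O) (n : ℕ)
    (h : ∀ i k, k < reads i (B.history I n) → (J.list i)[k]? = (I.list i)[k]?) :
    B.history J n = B.history I n := by
  rw [B.history_map_of_agree (RelEmbedding.refl (· ≤ ·)) I J n]
  · rw [show Event.map (m := m) (RelEmbedding.refl (· ≤ · : O → O → Prop)) = id from
      funext Event.map_refl, List.map_id]
  · intro i k hk
    rw [h i k hk]
    cases (I.list i)[k]? <;> rfl

end Histories

/-! ### Inputs and their minimal intervals -/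

section Inputs

variable {m : ℕ} {O P : Type} [LinearOrder O] [LinearOrder P]

/-- A list that an input may contain. -/
def ValidList (l : List (NonemptyInterval O)) : Prop :=
  l ≠ [] ∧ l.Pairwise fun x y => x.fst < y.fst ∧ x.snd < y.snd

/-- In an antichain, right extremes must increase together with left extremes, for otherwise a later
interval would be contained in an earlier one. -/
theorem Input.validList (I : Input m O) (i : Fin m) : ValidList (I.list i) := by
  refine ⟨I.nonempty i, (I.sorted i).imp_of_mem fun {x y} hx hy hxy => ⟨hxy, ?_⟩⟩
  by_contra hle
  have := I.antichain i hy hx (by rintro rfl; exact lt_irrefl _ hxy)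
  exact this (NonemptyInterval.le_def.2 ⟨hxy.le, not_lt.1 hle⟩)

theorem ValidList.getElem?_lt {l : List (NonemptyInterval O)} (h : ValidList l) {a b : ℕ}
    {x y : NonemptyInterval O} (hx : l[a]? = some x) (hy : l[b]? = some y) (hab : a < b) :
    x.fst < y.fst ∧ x.snd < y.snd := by
  obtain ⟨ha, rfl⟩ := List.getElem?_eq_some_iff.1 hx
  obtain ⟨hb, rfl⟩ := List.getElem?_eq_some_iff.1 hy
  exact List.pairwise_iff_getElem.1 h.2 a b ha hb hab

theorem ValidList.getElem?_le {l : List (NonemptyInterval O)} (h : ValidList l) {a b : ℕ}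
    {x y : NonemptyInterval O} (hx : l[a]? = some x) (hy : l[b]? = some y) (hab : a ≤ b) :
    x.fst ≤ y.fst ∧ x.snd ≤ y.snd := by
  rcases hab.eq_or_lt with rfl | hab
  · obtain rfl : x = y := Option.some.inj (hx.symm.trans hy)
    exact ⟨le_rfl, le_rfl⟩
  · exact ⟨(h.getElem?_lt hx hy hab).1.le, (h.getElem?_lt hx hy hab).2.le⟩

theorem ValidList.eq_of_le {l : List (NonemptyInterval O)} (h : ValidList l)
    {x y : NonemptyInterval O} (hx : x ∈ l) (hy : y ∈ l) (hxy : x ≤ y) : x = y := by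
  obtain ⟨a, ha⟩ := List.mem_iff_getElem?.1 hx
  obtain ⟨b, hb⟩ := List.mem_iff_getElem?.1 hy
  rw [NonemptyInterval.le_def] at hxy
  rcases lt_trichotomy a b with hab | rfl | hab
  · exact absurd hxy.1 (h.getElem?_lt ha hb hab).1.not_ge
  · exact Option.some.inj (ha.symm.trans hb)
  · exact absurd hxy.2 (h.getElem?_lt hb ha hab).2.not_ge

/-- The input made of the given lists. -/
def Input.ofValid (l : Fin m → List (NonemptyInterval O)) (h : ∀ i, ValidList (l i)) :
    Input m O where
  list := l
  nonempty i := (h i).1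
  sorted i := (h i).2.imp And.left
  antichain i _ hx _ hy hxy hle := hxy ((h i).eq_of_le hx hy hle)

theorem ValidList.map {l : List (NonemptyInterval O)} (h : ValidList l) (f : O ↪o P) :
    ValidList (l.map (mapInterval f)) := by
  refine ⟨by simpa using h.1, List.pairwise_map.2 (h.2.imp fun {x y} hxy => ?_)⟩
  exact ⟨f.lt_iff_lt.2 hxy.1, f.lt_iff_lt.2 hxy.2⟩

theorem ValidList.take {l : List (NonemptyInterval O)} (h : ValidList l) {k : ℕ} (hk : 0 < k) :
    ValidList (l.take k) := by
  refine ⟨?_, h.2.take⟩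
  simp only [ne_eq, List.take_eq_nil_iff, not_or]
  exact ⟨hk.ne', h.1⟩

/-- A prefix of a list can be continued by an interval to the right. -/
theorem ValidList.take_append {l : List (NonemptyInterval O)} (h : ValidList l) (f : O ↪o P)
    (k : ℕ) (y : NonemptyInterval P)
    (hy : ∀ a < k, ∀ x, l[a]? = some x → f x.fst < y.fst ∧ f x.snd < y.snd) :
    ValidList ((l.take k).map (mapInterval f) ++ [y]) := by
  refine ⟨by simp, List.pairwise_append.2 ⟨List.pairwise_map.2 (h.2.take.imp fun {x y} hxy =>
    ⟨f.lt_iff_lt.2 hxy.1, f.lt_iff_lt.2 hxy.2⟩), List.pairwise_singleton _ _, ?_⟩⟩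
  simp only [List.mem_map, List.mem_singleton, forall_eq, forall_exists_index, and_imp]
  rintro _ x hx rfl
  obtain ⟨a, ha⟩ := List.mem_iff_getElem?.1 hx
  rw [List.getElem?_take] at ha
  split_ifs at ha with hak
  exact hy a hak x ha

theorem getElem?_take_append {l : List (NonemptyInterval O)} (f : O ↪o P) {k a : ℕ}
    (y : NonemptyInterval P) (ha : a < k) (hk : k ≤ l.length) :
    ((l.take k).map (mapInterval f) ++ [y])[a]? = (l[a]?).map (mapInterval f) := by
  rw [List.getElem?_append_left (by simp; omega), List.getElem?_map, List.getElem?_take,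
    if_pos ha]

/-- Each list contains an interval contained in `c`. -/
def Covers (I : Input m O) (c : NonemptyInterval O) : Prop := ∀ i, ∃ x ∈ I.list i, x ≤ c

theorem eq_of_minimal_of_fst_eq {I : Input m O} {c d : NonemptyInterval O}
    (hc : Minimal (Covers I) c) (hd : Minimal (Covers I) d) (h : c.fst = d.fst) : c = d := by
  rcases le_total c.snd d.snd with hs | hs
  · have hle : c ≤ d := NonemptyInterval.le_def.2 ⟨h.ge, hs⟩
    exact le_antisymm hle (hd.2 hc.1 hle)
  · have hle : d ≤ c := NonemptyInterval.le_def.2 ⟨h.le, hs⟩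
    exact le_antisymm (hc.2 hd.1 hle) hle

/-- A covering interval inside `c` contains an element of the same list as `c`, and by the antichain
property this element is `c`. -/
theorem minimal_of_mem {I : Input m O} {c : NonemptyInterval O} (hc : Covers I c) {i : Fin m}
    (h : c ∈ I.list i) : Minimal (Covers I) c := by
  refine ⟨hc, fun d hd hdc => ?_⟩
  obtain ⟨x, hx, hxd⟩ := hd i
  rwa [← (I.validList i).eq_of_le hx h (hxd.trans hdc)]

/-- Otherwise the left extreme of `c` could be moved right, to the leftmost of the elements
witnessing the covering. This bounds the number of outputs in the proof of termination. -/
theorem exists_fst_eq_of_minimal (hm : 1 ≤ m) {I : Input m O} {c : NonemptyInterval O}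
    (h : Minimal (Covers I) c) : ∃ i, ∃ x ∈ I.list i, x.fst = c.fst := by
  choose x hx hxc using h.1
  obtain ⟨i, -, hi⟩ := Finset.exists_min_image Finset.univ (fun i => (x i).fst)
    ⟨(⟨0, hm⟩ : Fin m), Finset.mem_univ _⟩
  have hxc' := fun j => NonemptyInterval.le_def.1 (hxc j)
  refine ⟨i, x i, hx i, le_antisymm ?_ (hxc' i).1⟩
  have hcov : Covers I ⟨((x i).fst, c.snd), (x i).fst_le_snd.trans (hxc' i).2⟩ := fun j =>
    ⟨x j, hx j, NonemptyInterval.le_def.2 ⟨hi j (Finset.mem_univ j), (hxc' j).2⟩⟩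
  exact (NonemptyInterval.le_def.1
    (h.2 hcov (NonemptyInterval.le_def.2 ⟨(hxc' i).1, le_rfl⟩))).1

end Inputs

/-! ### The queue -/

section Queue

variable {m : ℕ} {O : Type} [LinearOrder O]

namespace State

/-- `x` is the interval spanned by a full queue. -/
structure SpanIs (s : State m O) (x : NonemptyInterval O) : Prop where
  eq : s.span = x
  le : ∀ i y, s.ref i = some y → y ≤ x
  fst : ∃ i y, s.ref i = some y ∧ y.fst = x.fst
  snd : ∃ i y, s.ref i = some y ∧ y.snd = x.snd

theorem exists_spanIs (hm : 1 ≤ m) {s : State m O} (hf : s.Full) : ∃ x, s.SpanIs x := by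
  choose y hy using fun i => Option.isSome_iff_exists.1 (hf i)
  have hne : (Finset.univ : Finset (Fin m)).Nonempty := ⟨⟨0, hm⟩, Finset.mem_univ _⟩
  obtain ⟨a, -, ha⟩ := Finset.exists_min_image Finset.univ (fun i => (y i).fst) hne
  obtain ⟨b, -, hb⟩ := Finset.exists_max_image Finset.univ (fun i => (y i).snd) hne
  have hle (i) : (y i : WithBot (NonemptyInterval O)) ≤ s.span := by
    have := Finset.le_sup (s := Finset.univ) (f := fun i => (s.ref i).elim ⊥ fun x =>
      (x : WithBot (NonemptyInterval O))) (Finset.mem_univ i)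
    simpa [hy, span] using this
  let x : NonemptyInterval O :=
    ⟨((y a).fst, (y b).snd), (y a).fst_le_snd.trans (hb a (Finset.mem_univ _))⟩
  have hx (i) : y i ≤ x :=
    NonemptyInterval.le_def.2 ⟨ha i (Finset.mem_univ _), hb i (Finset.mem_univ _)⟩
  refine ⟨x, ?_, ?_, ⟨a, y a, hy a, rfl⟩, ⟨b, y b, hy b, rfl⟩⟩
  · apply le_antisymm
    · refine Finset.sup_le fun i _ => ?_
      simpa [hy] using hx i
    · have h1 := hle a
      have h2 := hle b
      revert h1 h2
      cases s.span with
      | bot => simp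
      | coe d =>
        simp only [WithBot.coe_le_coe, NonemptyInterval.le_def]
        exact fun h1 h2 => ⟨h1.1, h2.2⟩
  · intro i z hz
    obtain rfl : y i = z := Option.some.inj ((hy i).symm.trans hz)
    exact hx i

theorem topIndices_nonempty (hm : 1 ≤ m) {s : State m O} (hf : s.Full) :
    s.topIndices.Nonempty := by
  choose y hy using fun i => Option.isSome_iff_exists.1 (hf i)
  -- `Prec` is the lexicographic order with the order on right extremes reversed.
  obtain ⟨a, -, ha⟩ := Finset.exists_min_image Finset.univ
    (fun i => toLex ((y i).fst, OrderDual.toDual (y i).snd))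
    ⟨(⟨0, hm⟩ : Fin m), Finset.mem_univ _⟩
  refine ⟨a, ?_⟩
  simp only [topIndices, Finset.mem_filter, Finset.mem_univ, true_and]
  refine ⟨y a, hy a, hy a, fun j z hz => ?_⟩
  obtain rfl : y j = z := Option.some.inj ((hy j).symm.trans hz)
  have := ha j (Finset.mem_univ _)
  rw [Prod.Lex.le_iff] at this
  exact this

theorem exists_isTop_of_mem_topIndices {s : State m O} {i : Fin m} (h : i ∈ s.topIndices) :
    ∃ y, s.IsTop i y := by
  simp only [topIndices, Finset.mem_filter] at h
  obtain ⟨-, y, -, hy⟩ := h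
  exact ⟨y, hy⟩

theorem SpanIs.fst_eq_of_isTop {s : State m O} {x y : NonemptyInterval O} (h : s.SpanIs x)
    {i : Fin m} (hy : s.IsTop i y) : y.fst = x.fst := by
  apply le_antisymm
  · obtain ⟨j, z, hz, hzx⟩ := h.fst
    rw [← hzx]
    rcases hy.2 j z hz with hlt | heq
    · exact hlt.le
    · exact heq.1.le
  · exact (NonemptyInterval.le_def.1 (h.le i y hy.1)).1

theorem SpanIs.isTop_iff {s : State m O} {x : NonemptyInterval O} (h : s.SpanIs x)
    {i : Fin m} : s.IsTop i x ↔ s.ref i = some x := by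
  refine ⟨fun hx => hx.1, fun hx => ⟨hx, fun j y hy => ?_⟩⟩
  have := NonemptyInterval.le_def.1 (h.le j y hy)
  rcases this.1.lt_or_eq with hlt | heq
  · exact Or.inl hlt
  · exact Or.inr ⟨heq, this.2⟩

theorem SpanIs.cLeSpan_iff {s : State m O} {x c : NonemptyInterval O} (h : s.SpanIs x)
    (hc : s.c = some c) : s.CLeSpan ↔ c ≤ x := by
  simp [CLeSpan, hc, h.eq]

theorem SpanIs.spanLeC_iff {s : State m O} {x c : NonemptyInterval O} (h : s.SpanIs x)
    (hc : s.c = some c) : s.SpanLeC ↔ x ≤ c := by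
  simp [SpanLeC, hc, h.eq]

theorem SpanIs.body_eq {s : State m O} {x : NonemptyInterval O} (h : s.SpanIs x) :
    s.body = if ∃ i, s.ref i = some x then ({ s with c := some x, loop := .first }, .ret x)
      else ({ s with c := some x, loop := .second }, .advance) := by
  simp only [body, h.eq, h.isTop_iff]

theorem after_append {h : List (Event m O)} (hh : m ≤ h.length) (e : Event m O) :
    after (h ++ [e]) = (after h).control.1.receive e := by
  rw [after, initial, List.take_append_of_le_length hh, List.drop_append_of_le_length hh,
    List.foldl_append]
  rfl

end State

/-! ### The invariant of the algorithm -/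

/-- `x` has been read from the `i`-th list, and it has been replaced by its successor or null. -/
def Passed (I : Input m O) (h : List (Event m O)) (i : Fin m) (x : NonemptyInterval O) : Prop :=
  ∃ k, k + 1 < reads i h ∧ (I.list i)[k]? = some x

/-- The outputs so far are the minimal intervals whose left extreme satisfies `p`. -/
structure Emitted (I : Input m O) (h : List (Event m O)) (p : O → Prop) : Prop where
  sorted : (outputs h).Pairwise fun c d => c.fst < d.fst
  mem_iff : ∀ d, d ∈ outputs h ↔ Minimal (Covers I) d ∧ p d.fst

/-- The queue contains the last element read from each list. -/
structure Synced (I : Input m O) (h : List (Event m O)) (s : State m O) : Prop where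
  pos : ∀ i, 0 < reads i h
  le : ∀ i, reads i h ≤ (I.list i).length + 1
  ref_eq : ∀ i, s.ref i = (I.list i)[reads i h - 1]?

/-- An interval with right extreme at least that of `c` has been read. -/
def Attained (I : Input m O) (h : List (Event m O)) (c : NonemptyInterval O) : Prop :=
  ∃ i k y, k < reads i h ∧ (I.list i)[k]? = some y ∧ c.snd ≤ y.snd

/-- `c` has the least possible right extreme for its left extreme, and it is going to be returned
unless it is shrunk. -/
structure Candidate (I : Input m O) (h : List (Event m O)) (c : NonemptyInterval O) : Prop where
  covers : Covers I c
  passed : ∀ i y, Passed I h i y → y.fst ≤ c.fst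
  last : ∀ i y, (I.list i)[reads i h - 1]? = some y → c.fst ≤ y.fst
  bound : ∀ d, Covers I d → c.fst ≤ d.fst → c.snd ≤ d.snd
  attained : Attained I h c
  emitted : Emitted I h (· < c.fst)
  -- When `c` itself is in a list, nothing starting with `c` has been replaced: no read has been
  -- spent on trying to shrink it.
  top : ∀ i, c ∈ I.list i → ∀ j y, Passed I h j y → y.fst < c.fst

/-- The invariant that holds before each execution of `control`. -/
inductive Inv (I : Input m O) (h : List (Event m O)) (s : State m O) : Prop
  | start (hc : s.c = none) (hl : s.loop = .first) (hr : ∀ i, reads i h = 1)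
      (ho : outputs h = [])
  | emitted (c : NonemptyInterval O) (hc : s.c = some c) (hl : s.loop = .first)
      (hp : ∀ i y, Passed I h i y → y.fst ≤ c.fst) (ha : Attained I h c)
      (he : Emitted I h (· ≤ c.fst))
  | pending (c : NonemptyInterval O) (hc : s.c = some c) (hl : s.loop = .second)
      (hp : Candidate I h c) (hn : ∀ i, c ∉ I.list i)

/-- What can happen when `control` is executed. -/
inductive Outcome (I : Input m O) (h : List (Event m O)) (s : State m O) : Prop
  | sweep (c x : NonemptyInterval O) (hs : s.control = (s, .advance)) (hl : s.loop = .first)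
      (hc : s.c = some c) (hf : s.Full) (hx : s.SpanIs x) (hxc : x.fst ≤ c.fst)
      (hp : ∀ i y, Passed I h i y → y.fst ≤ c.fst) (ha : Attained I h c)
      (he : Emitted I h (· ≤ c.fst))
  | shrink (x : NonemptyInterval O)
      (hs : s.control = ({ s with c := some x, loop := .second }, .advance)) (hf : s.Full)
      (hx : s.SpanIs x) (hp : Candidate I h x) (hn : ∀ i, x ∉ I.list i)
  | emit (x : NonemptyInterval O)
      (hs : s.control = ({ s with c := some x, loop := .first }, .ret x))
      (hp : Candidate I h x) (hmin : Minimal (Covers I) x)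
  | done (hs : s.control = (s, .retNull)) (he : Emitted I h fun _ => True)

variable {I : Input m O} {h : List (Event m O)} {s : State m O}

/-! ### One execution of `control`. -/

theorem Synced.passed_or (hs : Synced I h s) {i : Fin m} {x : NonemptyInterval O}
    (hx : x ∈ I.list i) :
    Passed I h i x ∨ ∃ y, s.ref i = some y ∧ y.fst ≤ x.fst ∧ y.snd ≤ x.snd := by
  obtain ⟨k, hk⟩ := List.mem_iff_getElem?.1 hx
  by_cases hlt : k + 1 < reads i h
  · exact Or.inl ⟨k, hlt, hk⟩
  · right
    have hkl := (List.getElem?_eq_some_iff.1 hk).1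
    have hy := List.getElem?_eq_getElem (l := I.list i) (i := reads i h - 1) (by omega)
    exact ⟨_, (hs.ref_eq i).trans hy, (I.validList i).getElem?_le hy hk (by omega)⟩

theorem Synced.ref_mem (hs : Synced I h s) {i : Fin m} {x : NonemptyInterval O}
    (hx : s.ref i = some x) : x ∈ I.list i :=
  List.mem_of_getElem? ((hs.ref_eq i).symm.trans hx)

theorem Synced.attained (hs : Synced I h s) {x : NonemptyInterval O} (hx : s.SpanIs x) :
    Attained I h x := by
  obtain ⟨i, y, hy, hyx⟩ := hx.snd
  have := hs.pos i
  exact ⟨i, reads i h - 1, y, by omega, (hs.ref_eq i).symm.trans hy, hyx.ge⟩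

theorem Synced.covers (hs : Synced I h s) (hf : s.Full) {x : NonemptyInterval O}
    (hx : s.SpanIs x) : Covers I x := fun i => by
  obtain ⟨y, hy⟩ := Option.isSome_iff_exists.1 (hf i)
  exact ⟨y, hs.ref_mem hy, hx.le i y hy⟩

theorem Synced.last (hs : Synced I h s) {x : NonemptyInterval O} (hx : s.SpanIs x) {i : Fin m}
    {y : NonemptyInterval O} (hy : (I.list i)[reads i h - 1]? = some y) : x.fst ≤ y.fst :=
  (NonemptyInterval.le_def.1 (hx.le i y ((hs.ref_eq i).trans hy))).1

/-- Right extremes grow along each list, so a full queue spans at least as far right as anything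
read. -/
theorem Synced.snd_le_of_attained (hs : Synced I h s) (hf : s.Full) {x c : NonemptyInterval O}
    (hx : s.SpanIs x) (hc : Attained I h c) : c.snd ≤ x.snd := by
  obtain ⟨i, k, y, hk, hy, hcy⟩ := hc
  obtain ⟨z, hz⟩ := Option.isSome_iff_exists.1 (hf i)
  exact (hcy.trans ((I.validList i).getElem?_le hy ((hs.ref_eq i).symm.trans hz)
    (by omega)).2).trans (NonemptyInterval.le_def.1 (hx.le i z hz)).2

/-- An interval starting after all elements that have been passed ends after the span. -/
theorem Synced.snd_le_of_covers (hs : Synced I h s) {x d : NonemptyInterval O}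
    (hx : s.SpanIs x) (hd : Covers I d) (hp : ∀ i y, Passed I h i y → y.fst < d.fst) :
    x.snd ≤ d.snd := by
  -- The list whose current item reaches the right end of the span: its elements inside `d` have not
  -- been passed, so they end no earlier than that item.
  obtain ⟨i, y, hy, hyx⟩ := hx.snd
  obtain ⟨z, hz, hzd⟩ := hd i
  rw [NonemptyInterval.le_def] at hzd
  rcases hs.passed_or hz with hpz | ⟨w, hw, -, hwz⟩
  · exact absurd hzd.1 (hp i z hpz).not_ge
  · obtain rfl : y = w := Option.some.inj (hy.symm.trans hw)
    rw [← hyx]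
    exact hwz.trans hzd.2

theorem fst_le_of_minimal {x d : NonemptyInterval O} (hx : Covers I x)
    (hd : Minimal (Covers I) d) (hsnd : x.snd ≤ d.snd) : x.fst ≤ d.fst := by
  by_contra hlt
  have hle : x ≤ d := NonemptyInterval.le_def.2 ⟨(not_le.1 hlt).le, hsnd⟩
  exact hlt (NonemptyInterval.le_def.1 (hd.2 hx hle)).1

theorem Synced.exists_passed (hs : Synced I h s) (hf : ¬ s.Full) :
    ∃ i, ∀ x ∈ I.list i, Passed I h i x := by
  simp only [State.Full, not_forall] at hf
  obtain ⟨i, hi⟩ := hf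
  refine ⟨i, fun x hx => (hs.passed_or hx).resolve_right ?_⟩
  rintro ⟨y, hy, -⟩
  exact hi (by simp [hy])

/-- The test of `body` decides whether the candidate is in some list. If it is, it is minimal by the
antichain property and can be returned immediately. -/
theorem Synced.outcome_of_body (hs : Synced I h s) (hf : s.Full) {x : NonemptyInterval O}
    (hx : s.SpanIs x) (hctl : s.control = s.body) (hp : Candidate I h x) : Outcome I h s := by
  rw [hx.body_eq] at hctl
  split_ifs at hctl with htop
  · obtain ⟨i, hi⟩ := htop
    exact .emit x hctl hp (minimal_of_mem hp.covers (hs.ref_mem hi))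
  -- An occurrence of `x` in list `i` cannot have been passed, by `top`; otherwise the current item
  -- of that list, which lies inside the span `x`, would be `x`, against the failure of the test.
  · refine .shrink x hctl hf hx hp fun i hi => ?_
    rcases hs.passed_or hi with hpx | ⟨y, hy, -⟩
    · exact lt_irrefl _ (hp.top i hi i x hpx)
    · obtain rfl := (I.validList i).eq_of_le (hs.ref_mem hy) hi (hx.le i y hy)
      exact htop ⟨i, hy⟩

theorem Synced.candidate (hs : Synced I h s) (hf : s.Full) {x : NonemptyInterval O}
    (hx : s.SpanIs x) (hp : ∀ i y, Passed I h i y → y.fst < x.fst)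
    (he : Emitted I h (· < x.fst)) : Candidate I h x where
  covers := hs.covers hf hx
  passed i y hy := (hp i y hy).le
  last _ _ hy := hs.last hx hy
  bound _ hd hxd := hs.snd_le_of_covers hx hd fun i y hy => (hp i y hy).trans_le hxd
  attained := hs.attained hx
  emitted := he
  top _ _ := hp

/-- The span never ends before `c`, so comparing it with `c` reduces to comparing one extreme.
Moving the threshold from `c` to a span starting later skips no output, because a minimal interval
starting after all passed elements ends no earlier than the span, and so cannot start before it. -/
theorem Inv.outcome (hm : 1 ≤ m) (hs : Synced I h s) (hi : Inv I h s) : Outcome I h s := by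
  cases hi with
  | start hc hl hr ho =>
    have hp : ∀ i y, ¬ Passed I h i y := by
      rintro i y ⟨k, hk, -⟩
      rw [hr] at hk
      omega
    have hf : s.Full := by
      by_contra hf
      obtain ⟨i, hi⟩ := hs.exists_passed hf
      obtain ⟨x, hx⟩ := List.exists_mem_of_ne_nil _ (I.nonempty i)
      exact hp i x (hi x hx)
    obtain ⟨x, hx⟩ := State.exists_spanIs hm hf
    refine hs.outcome_of_body hf hx ?_ (hs.candidate hf hx (fun i y hy => absurd hy (hp i y))
      ⟨by simp [ho], fun d => ?_⟩)
    · simp [State.control, hl, hf, State.CLeSpan, hc]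
    · simp only [ho, List.not_mem_nil, false_iff, not_and, not_lt]
      exact fun hd => fst_le_of_minimal (hs.covers hf hx) hd
        (hs.snd_le_of_covers hx hd.1 fun i y hy => absurd hy (hp i y))
  | emitted c hc hl hp ha he =>
    by_cases hf : s.Full
    · obtain ⟨x, hx⟩ := State.exists_spanIs hm hf
      by_cases hcx : c ≤ x
      · exact .sweep c x (by simp [State.control, hl, hf, (hx.cLeSpan_iff hc).2 hcx]) hl hc hf hx
          (NonemptyInterval.le_def.1 hcx).1 hp ha he
      · have hlt : c.fst < x.fst := by
          by_contra hle
          exact hcx (NonemptyInterval.le_def.2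
            ⟨not_lt.1 hle, hs.snd_le_of_attained hf hx ha⟩)
        refine hs.outcome_of_body hf hx
          (by simp [State.control, hl, hf, hx.cLeSpan_iff hc, hcx])
          (hs.candidate hf hx (fun i y hy => (hp i y hy).trans_lt hlt)
            ⟨he.sorted, fun d => (he.mem_iff d).trans ?_⟩)
        refine and_congr_right fun hd => ⟨fun hdc => hdc.trans_lt hlt, fun hdx => ?_⟩
        by_contra hcd
        exact hdx.not_ge (fst_le_of_minimal (hs.covers hf hx) hd
          (hs.snd_le_of_covers hx hd.1 fun i y hy => (hp i y hy).trans_lt (not_le.1 hcd)))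
    · refine .done (by simp [State.control, hl, hf]) ⟨he.sorted, fun d => (he.mem_iff d).trans ?_⟩
      refine and_congr_right fun hd => iff_true_intro ?_
      -- An exhausted list has only elements starting at or before `c`, so no covering interval
      -- starts later.
      obtain ⟨i, hi⟩ := hs.exists_passed hf
      obtain ⟨y, hy, hyd⟩ := hd.1 i
      exact (NonemptyInterval.le_def.1 hyd).1.trans (hp i y (hi y hy))
  | pending c hc hl hp hn =>
    by_cases hfull : s.Full ∧ s.SpanLeC
    · obtain ⟨hf, hsp⟩ := hfull
      obtain ⟨x, hx⟩ := State.exists_spanIs hm hf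
      have hctl : s.control = s.body := by simp [State.control, hl, hf, hsp]
      have hxc := NonemptyInterval.le_def.1 ((hx.spanLeC_iff hc).1 hsp)
      have hsnd := le_antisymm hxc.2 (hs.snd_le_of_attained hf hx hp.attained)
      -- The right extreme is unchanged: either the candidate is the same, because of a tie on the
      -- left, or it has been shrunk from the left.
      rcases hxc.1.eq_or_lt with heq | hlt
      · obtain rfl : x = c := NonemptyInterval.ext (Prod.ext heq.symm hsnd)
        exact hs.outcome_of_body hf hx hctl hp
      · refine hs.outcome_of_body hf hx hctl
          (hs.candidate hf hx (fun i y hy => (hp.passed i y hy).trans_lt hlt)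
            ⟨hp.emitted.sorted, fun d => (hp.emitted.mem_iff d).trans ?_⟩)
        refine and_congr_right fun hd => ⟨fun hdc => hdc.trans hlt, fun hdx => ?_⟩
        by_contra hcd
        exact hdx.not_ge (fst_le_of_minimal (hs.covers hf hx) hd
          (hsnd.le.trans (hp.bound d hd.1 (not_lt.1 hcd))))
    · have hctl : s.control = ({ s with c := some c, loop := .first }, .ret c) := by
        cases s
        simp only at hc hl
        subst hc hl
        simp [State.control, hfull]
      -- A smaller covering `d` would have to start after `c`, by `bound`, hence after every passed
      -- element. A full queue would then span an interval inside `c`, and the loop would not have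
      -- stopped; an exhausted list would have no element in `d`.
      refine .emit c hctl hp ⟨hp.covers, fun d hd hdc => ?_⟩
      rw [NonemptyInterval.le_def] at hdc
      refine NonemptyInterval.le_def.2 ⟨?_, hp.bound d hd hdc.1⟩
      by_contra hlt
      rw [not_le] at hlt
      by_cases hf : s.Full
      · obtain ⟨x, hx⟩ := State.exists_spanIs hm hf
        have hnle : ¬ x ≤ c := fun hle => hfull ⟨hf, (hx.spanLeC_iff hc).2 hle⟩
        obtain ⟨i, y, hy, hyx⟩ := hx.fst
        have hfst : c.fst ≤ x.fst := hyx ▸ hp.last i y ((hs.ref_eq i).symm.trans hy)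
        refine hnle (NonemptyInterval.le_def.2 ⟨hfst, le_trans ?_ hdc.2⟩)
        exact hs.snd_le_of_covers hx hd fun i y hy => (hp.passed i y hy).trans_lt hlt
      · obtain ⟨i, hi⟩ := hs.exists_passed hf
        obtain ⟨y, hy, hyd⟩ := hd i
        exact ((hp.passed i y (hi y hy)).trans_lt hlt).not_ge (NonemptyInterval.le_def.1 hyd).1

end Queue

/-! ### Runs of the algorithm -/

section Runs

variable {m : ℕ} {O : Type} [LinearOrder O] {I : Input m O} {h : List (Event m O)}
  {s : State m O}

/-! ### Effect of a single event on the invariant. -/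

theorem reads_append_read (i j : Fin m) (x : Option (NonemptyInterval O)) :
    reads j (h ++ [.read i x]) = reads j h + if i = j then 1 else 0 := by
  simp [reads_append, reads]

theorem reads_append_emit (j : Fin m) (c : NonemptyInterval O) :
    reads j (h ++ [.emit c]) = reads j h := by
  simp [reads_append, reads]

theorem outputs_append_read (i : Fin m) (x : Option (NonemptyInterval O)) :
    outputs (h ++ [.read i x]) = outputs h := by
  simp [outputs_append, outputs]

theorem outputs_append_emit (c : NonemptyInterval O) :
    outputs (h ++ [.emit c]) = outputs h ++ [c] := by
  simp [outputs_append, outputs]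

theorem Passed.of_append_read {i j : Fin m} {x : Option (NonemptyInterval O)}
    {y : NonemptyInterval O} (hp : Passed I (h ++ [.read i x]) j y) :
    Passed I h j y ∨ j = i ∧ (I.list i)[reads i h - 1]? = some y := by
  obtain ⟨k, hk, hy⟩ := hp
  rw [reads_append_read] at hk
  by_cases hlt : k + 1 < reads j h
  · exact Or.inl ⟨k, hlt, hy⟩
  · by_cases hij : i = j
    · subst hij
      rw [if_pos rfl] at hk
      exact Or.inr ⟨rfl, by rwa [show reads i h - 1 = k by omega]⟩
    · rw [if_neg hij] at hk
      omega

theorem Attained.append {c : NonemptyInterval O} (ha : Attained I h c) (e : Event m O) :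
    Attained I (h ++ [e]) c := by
  obtain ⟨i, k, y, hk, hy⟩ := ha
  exact ⟨i, k, y, by rw [reads_append]; omega, hy⟩

theorem Emitted.append_read {p : O → Prop} (he : Emitted I h p) (i : Fin m)
    (x : Option (NonemptyInterval O)) : Emitted I (h ++ [.read i x]) p := by
  constructor
  · rw [outputs_append_read]; exact he.sorted
  · rw [outputs_append_read]; exact he.mem_iff

theorem Emitted.append_emit {c : NonemptyInterval O} (he : Emitted I h (· < c.fst))
    (hc : Minimal (Covers I) c) : Emitted I (h ++ [.emit c]) (· ≤ c.fst) := by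
  constructor
  · rw [outputs_append_emit, List.pairwise_append]
    refine ⟨he.sorted, List.pairwise_singleton _ _, ?_⟩
    simp only [List.mem_singleton, forall_eq]
    exact fun d hd => ((he.mem_iff d).1 hd).2
  · intro d
    rw [outputs_append_emit, List.mem_append, List.mem_singleton, he.mem_iff]
    constructor
    · rintro (⟨hd, hlt⟩ | rfl)
      · exact ⟨hd, le_of_lt hlt⟩
      · exact ⟨hc, le_rfl⟩
    · rintro ⟨hd, hle⟩
      rcases (show d.fst ≤ c.fst from hle).lt_or_eq with hlt | heq
      · exact Or.inl ⟨hd, hlt⟩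
      · exact Or.inr (eq_of_minimal_of_fst_eq hd hc heq)

theorem Synced.append_emit (hs : Synced I h s) {t : State m O} (ht : t.ref = s.ref)
    (c : NonemptyInterval O) : Synced I (h ++ [.emit c]) t := by
  constructor <;> simp only [reads_append_emit, ht]
  exacts [hs.pos, hs.le, hs.ref_eq]

theorem Synced.append_read (hs : Synced I h s) (hf : s.Full) {t : State m O} (ht : t.ref = s.ref)
    (i : Fin m) : Synced I (h ++ [.read i (I.list i)[reads i h]?])
      (t.receive (.read i (I.list i)[reads i h]?)) := by
  have hpos := hs.pos
  constructor
  · intro j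
    rw [reads_append_read]
    have := hpos j
    omega
  · intro j
    rw [reads_append_read]
    split_ifs with hij
    · subst hij
      obtain ⟨y, hy⟩ := Option.isSome_iff_exists.1 (hf i)
      have := (List.getElem?_eq_some_iff.1 ((hs.ref_eq i).symm.trans hy)).1
      omega
    · exact hs.le j
  · intro j
    rw [reads_append_read]
    by_cases hij : i = j
    · subst hij
      simp [State.receive]
    · simp [State.receive, hij, Ne.symm hij, ht, hs.ref_eq]

/-- The replaced item starts with `x`, so the bounds on passed and current elements survive; `top`
is vacuous because `x` is in no list. -/
theorem Candidate.append_read {x : NonemptyInterval O} (hp : Candidate I h x)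
    (hn : ∀ i, x ∉ I.list i) {i : Fin m} {y : NonemptyInterval O}
    (hy : (I.list i)[reads i h - 1]? = some y) (hyx : y.fst = x.fst) :
    Candidate I (h ++ [.read i (I.list i)[reads i h]?]) x where
  covers := hp.covers
  passed j z hz := by
    rcases hz.of_append_read with hz | ⟨rfl, hz⟩
    · exact hp.passed j z hz
    · obtain rfl : y = z := Option.some.inj (hy.symm.trans hz)
      exact hyx.le
  last j z hz := by
    rw [reads_append_read] at hz
    split_ifs at hz with hij
    · subst hij
      exact hyx.ge.trans ((I.validList i).getElem?_le hy hz (by omega)).1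
    · exact hp.last j z hz
  bound := hp.bound
  attained := hp.attained.append _
  emitted := hp.emitted.append_read _ _
  top j hj := absurd hj (hn j)

variable (tie : TieRule m)

theorem andAct_of_le (hh : m ≤ h.length) :
    (andAlgorithm tie).act h = match (State.after h).control.2 with
      | .advance => .read (tie.choose h (State.after h).topIndices)
      | .ret c => .emit c
      | .retNull => .halt := by
  show andAct tie h = _
  exact dif_neg (by omega)

/-- The initial phase. -/
theorem history_initial (I : Input m O) {n : ℕ} (hn : n ≤ m) :
    ((andAlgorithm tie).history I n).length = n ∧
    outputs ((andAlgorithm tie).history I n) = [] ∧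
    (∀ i : Fin m, reads i ((andAlgorithm tie).history I n) = if i.1 < n then 1 else 0) ∧
    ((andAlgorithm tie).history I n).foldl State.receive
      { ref := fun _ => none, c := none, loop := .first } =
      { ref := fun i => if i.1 < n then (I.list i)[0]? else none, c := none, loop := .first } := by
  induction n with
  | zero => simp [Algorithm.history, outputs, reads]
  | succ n ih =>
    obtain ⟨h1, h2, h3, h4⟩ := ih (by omega)
    have hact : (andAlgorithm tie).act ((andAlgorithm tie).history I n) = .read ⟨n, hn⟩ := by
      show andAct tie _ = _
      rw [andAct, dif_pos (by omega)]
      simp only [h1]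
    have hr : reads ⟨n, hn⟩ ((andAlgorithm tie).history I n) = 0 := by simp [h3]
    rw [Algorithm.history_succ_of_read hact, hr]
    refine ⟨by simp [h1], by simp [outputs_append_read, h2], fun i => ?_, ?_⟩
    · rw [reads_append_read, h3]
      by_cases hi : i.1 = n
      · obtain rfl : i = ⟨n, hn⟩ := Fin.ext hi
        simp
      · have hne : (⟨n, hn⟩ : Fin m) ≠ i := fun he => hi (by simp [← he])
        simp only [hne, if_false, add_zero]
        congr 1
        simp only [eq_iff_iff]
        omega
    · rw [List.foldl_append, h4]
      simp only [List.foldl_cons, List.foldl_nil, State.receive, State.mk.injEq, and_true]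
      funext i
      by_cases hi : i = ⟨n, hn⟩
      · subst hi; simp
      · have hne : i.1 ≠ n := fun he => hi (Fin.ext he)
        rw [Function.update_of_ne hi]
        congr 1
        simp only [eq_iff_iff]
        omega

theorem le_length_history (I : Input m O) {n : ℕ} (hn : m ≤ n) :
    m ≤ ((andAlgorithm tie).history I n).length := by
  exact (history_initial tie I le_rfl).1.ge.trans
    ((andAlgorithm tie).history_prefix I hn).length_le

theorem le_of_reads_pos {n : ℕ} {i : Fin m}
    (hr : 0 < reads i ((andAlgorithm tie).history I n))
    (hact : (andAlgorithm tie).act ((andAlgorithm tie).history I n) = .read i) : m ≤ n := by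
  by_contra hlt
  obtain ⟨h1, -, h3, -⟩ := history_initial tie I (show n ≤ m by omega)
  have : (andAlgorithm tie).act ((andAlgorithm tie).history I n) = .read ⟨n, by omega⟩ := by
    show andAct tie _ = _
    rw [andAct, dif_pos (by omega)]
    simp only [h1]
  rw [this] at hact
  rw [h3] at hr
  injection hact with hact
  rw [← hact] at hr
  simp at hr

theorem after_initial (I : Input m O) : State.after ((andAlgorithm tie).history I m) =
    { ref := fun i => (I.list i)[0]?, c := none, loop := .first } := by
  obtain ⟨h1, -, -, h4⟩ := history_initial tie I le_rfl
  rw [State.after, State.initial, List.take_of_length_le h1.le, List.drop_of_length_le h1.le, h4]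
  simp

theorem inv_start (I : Input m O) :
    Synced I ((andAlgorithm tie).history I m) (State.after ((andAlgorithm tie).history I m)) ∧
    Inv I ((andAlgorithm tie).history I m) (State.after ((andAlgorithm tie).history I m)) := by
  obtain ⟨-, h2, h3, -⟩ := history_initial tie I le_rfl
  have h3' : ∀ i : Fin m, reads i ((andAlgorithm tie).history I m) = 1 := by simp [h3]
  rw [after_initial]
  refine ⟨⟨by simp [h3'], by simp [h3'], by simp [h3']⟩, .start rfl rfl h3' h2⟩

theorem inv_history (hm : 1 ≤ m) (I : Input m O) {n : ℕ} (hn : m ≤ n) :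
    Synced I ((andAlgorithm tie).history I n) (State.after ((andAlgorithm tie).history I n)) ∧
    Inv I ((andAlgorithm tie).history I n) (State.after ((andAlgorithm tie).history I n)) := by
  induction n, hn using Nat.le_induction with
  | base => exact inv_start tie I
  | succ n hn ih =>
    obtain ⟨hs, hi⟩ := ih
    have hlen := le_length_history tie I hn
    have hact := andAct_of_le tie hlen
    set h := (andAlgorithm tie).history I n with hh
    set s := State.after h with hsdef
    rcases hi.outcome hm hs with ⟨c, x, hctl, hl, hc, hf, hx, hxc, hp, ha, he⟩ |
      ⟨x, hctl, hf, hx, hp, hn⟩ | ⟨x, hctl, hp, hmin⟩ | ⟨hctl, he⟩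
    · rw [hctl] at hact
      obtain ⟨y, hy⟩ := State.exists_isTop_of_mem_topIndices
        (tie.choose_mem h _ (State.topIndices_nonempty hm hf))
      set i := tie.choose h s.topIndices
      have hyi := (hs.ref_eq i).symm.trans hy.1
      rw [Algorithm.history_succ_of_read hact, State.after_append hlen, ← hsdef, hctl]
      refine ⟨hs.append_read hf rfl i, .emitted c hc hl (fun j z hz => ?_) (ha.append _)
        (he.append_read _ _)⟩
      rcases hz.of_append_read with hz | ⟨-, hz⟩
      · exact hp j z hz
      · obtain rfl : y = z := Option.some.inj (hyi.symm.trans hz)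
        exact (hx.fst_eq_of_isTop hy).trans_le hxc
    · rw [hctl] at hact
      obtain ⟨y, hy⟩ := State.exists_isTop_of_mem_topIndices
        (tie.choose_mem h _ (State.topIndices_nonempty hm hf))
      set i := tie.choose h s.topIndices
      have hyi := (hs.ref_eq i).symm.trans hy.1
      rw [Algorithm.history_succ_of_read hact, State.after_append hlen, ← hsdef, hctl]
      exact ⟨hs.append_read (t := { s with c := some x, loop := .second }) hf rfl i,
        .pending x rfl rfl (hp.append_read hn hyi (hx.fst_eq_of_isTop hy)) hn⟩
    · rw [hctl] at hact
      rw [Algorithm.history_succ_of_emit hact, State.after_append hlen, ← hsdef, hctl]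
      refine ⟨hs.append_emit (t := { s with c := some x, loop := .first }) rfl x,
        .emitted x rfl rfl (fun j z hz => hp.passed j z ?_)
        (hp.attained.append _) (hp.emitted.append_emit hmin)⟩
      obtain ⟨k, hk, hz⟩ := hz
      exact ⟨k, by rwa [reads_append_emit] at hk, hz⟩
    · rw [hctl] at hact
      rw [Algorithm.history_succ_of_halt hact]
      exact ⟨hs, hi⟩

theorem outcome_history (hm : 1 ≤ m) (I : Input m O) {n : ℕ} (hn : m ≤ n) :
    Outcome I ((andAlgorithm tie).history I n)
      (State.after ((andAlgorithm tie).history I n)) :=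
  (inv_history tie hm I hn).2.outcome hm (inv_history tie hm I hn).1

theorem emitted_of_halt (hm : 1 ≤ m) {n : ℕ}
    (hact : (andAlgorithm tie).act ((andAlgorithm tie).history I n) = .halt) :
    Emitted I ((andAlgorithm tie).history I n) fun _ => True := by
  by_cases hn : m ≤ n
  · rw [andAct_of_le tie (le_length_history tie I hn)] at hact
    rcases outcome_history tie hm I hn with ⟨c, x, hctl, -⟩ | ⟨x, hctl, -⟩ | ⟨x, hctl, -⟩ |
      ⟨-, he⟩
    · simp [hctl] at hact
    · simp [hctl] at hact
    · simp [hctl] at hact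
    · exact he
  · obtain ⟨h1, -⟩ := history_initial tie I (show n ≤ m by omega)
    change andAct tie _ = _ at hact
    rw [andAct, dif_pos (by omega)] at hact
    cases hact

theorem candidate_of_emit (hm : 1 ≤ m) {n : ℕ} {c : NonemptyInterval O}
    (hact : (andAlgorithm tie).act ((andAlgorithm tie).history I n) = .emit c) :
    Candidate I ((andAlgorithm tie).history I n) c ∧ Minimal (Covers I) c := by
  by_cases hn : m ≤ n
  · rw [andAct_of_le tie (le_length_history tie I hn)] at hact
    rcases outcome_history tie hm I hn with ⟨c, x, hctl, -⟩ | ⟨x, hctl, -⟩ | ⟨x, hctl, hp, hmin⟩ |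
      ⟨hctl, -⟩
    · simp [hctl] at hact
    · simp [hctl] at hact
    · simp only [hctl, Action.emit.injEq] at hact
      subst hact
      exact ⟨hp, hmin⟩
    · simp [hctl] at hact
  · obtain ⟨h1, -⟩ := history_initial tie I (show n ≤ m by omega)
    change andAct tie _ = _ at hact
    rw [andAct, dif_pos (by omega)] at hact
    cases hact

theorem reads_history_le (hm : 1 ≤ m) (I : Input m O) (n : ℕ) (i : Fin m) :
    reads i ((andAlgorithm tie).history I n) ≤ (I.list i).length + 1 :=
  ((andAlgorithm tie).reads_mono I i (le_max_right m n)).trans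
    ((inv_history tie hm I (le_max_left m n)).1.le i)

theorem emitted_history (hm : 1 ≤ m) (I : Input m O) {n : ℕ} (hn : m ≤ n) :
    (outputs ((andAlgorithm tie).history I n)).Pairwise (fun c d => c.fst < d.fst) ∧
    ∀ d ∈ outputs ((andAlgorithm tie).history I n), Minimal (Covers I) d := by
  have (p : O → Prop) (he : Emitted I ((andAlgorithm tie).history I n) p) :
    (outputs ((andAlgorithm tie).history I n)).Pairwise (fun c d => c.fst < d.fst) ∧
    ∀ d ∈ outputs ((andAlgorithm tie).history I n), Minimal (Covers I) d :=
    ⟨he.sorted, fun d hd => ((he.mem_iff d).1 hd).1⟩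
  cases (inv_history tie hm I hn).2 with
  | start hc hl hr ho => simp [ho]
  | emitted c hc hl hp ha he => exact this _ he
  | pending c hc hl hp hn => exact this _ hp.emitted

/-- The algorithm terminates. -/
theorem exists_halt (hm : 1 ≤ m) (I : Input m O) :
    ∃ n, (andAlgorithm tie).act ((andAlgorithm tie).history I n) = .halt := by
  classical
  by_contra! hne
  have hlen (n : ℕ) : ((andAlgorithm tie).history I n).length = n := by
    induction n with
    | zero => rfl
    | succ n ih =>
      cases hact : (andAlgorithm tie).act ((andAlgorithm tie).history I n) with
      | read i => rw [Algorithm.history_succ_of_read hact]; simp [ih]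
      | emit c => rw [Algorithm.history_succ_of_emit hact]; simp [ih]
      | halt => exact absurd hact (hne n)
  -- Outputs have distinct left extremes, all belonging to this finite set.
  let F : Finset O := Finset.univ.biUnion fun i => ((I.list i).map fun x => x.fst).toFinset
  have hout (n : ℕ) (hn : m ≤ n) : (outputs ((andAlgorithm tie).history I n)).length ≤ F.card := by
    obtain ⟨h1, h2⟩ := emitted_history tie hm I hn
    have hnd : ((outputs ((andAlgorithm tie).history I n)).map fun x => x.fst).Nodup :=
      List.pairwise_map.2 (h1.imp ne_of_lt)
    rw [← List.length_map (fun x => x.fst), ← List.toFinset_card_of_nodup hnd]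
    refine Finset.card_le_card fun a ha => ?_
    simp only [List.mem_toFinset, List.mem_map] at ha
    obtain ⟨d, hd, rfl⟩ := ha
    obtain ⟨i, x, hx, hxd⟩ := exists_fst_eq_of_minimal hm (h2 d hd)
    simp only [F, Finset.mem_biUnion, Finset.mem_univ, true_and, List.mem_toFinset, List.mem_map]
    exact ⟨i, x, hx, hxd⟩
  -- More steps than the bounds on reads (null included) and outputs allow, and past the initial
  -- phase.
  let N := m + (∑ i, ((I.list i).length + 1) + F.card) + 1
  have h1 := length_eq_sum_reads_add_outputs ((andAlgorithm tie).history I N)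
  have h2 := Finset.sum_le_sum fun i (_ : i ∈ Finset.univ) => reads_history_le tie hm I N i
  have h3 := hout N (by omega)
  rw [hlen] at h1
  omega

/-- The algorithm computes the operator AND. -/
theorem exists_hasOutput (hm : 1 ≤ m) (I : Input m O) :
    ∃ L, (andAlgorithm tie).HasOutput I L ∧ L.Pairwise (fun c d => c.fst < d.fst) ∧
      ∀ d, d ∈ L ↔ Minimal (Covers I) d := by
  obtain ⟨n, hn⟩ := exists_halt tie hm I
  have he := emitted_of_halt tie hm hn
  exact ⟨_, ⟨n, hn, rfl⟩, he.sorted, fun d => (he.mem_iff d).trans (by simp)⟩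

/-- The set of minimal intervals, sorted by left extreme, does not depend on the tie rule. -/
theorem functionallyEquivalent_of_tieRule (hm : 1 ≤ m) (tie' : TieRule m) :
    FunctionallyEquivalent (andAlgorithm tie) (andAlgorithm tie') := by
  intro O _ I L
  obtain ⟨K, hK, hKs, hKm⟩ := exists_hasOutput tie hm I
  obtain ⟨K', hK', hKs', hKm'⟩ := exists_hasOutput tie' hm I
  have : K = K' := by
    have hperm : K.Perm K' := (List.perm_ext_iff_of_nodup
      (hKs.imp fun h he => by rw [he] at h; exact lt_irrefl _ h)
      (hKs'.imp fun h he => by rw [he] at h; exact lt_irrefl _ h)).2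
        fun d => (hKm d).trans (hKm' d).symm
    exact hperm.eq_of_pairwise (fun a b _ _ h1 h2 => absurd h1 h2.not_gt) hKs hKs'
  constructor
  · intro h
    rw [h.unique hK, this]
    exact hK'
  · intro h
    rw [h.unique hK', ← this]
    exact hK

end Runs

/-! ### What an equivalent algorithm has to read -/

section LowerBounds

variable {m : ℕ} {O : Type} [LinearOrder O] {I : Input m O}

theorem FunctionallyEquivalent.symm {A B : Algorithm m} (h : FunctionallyEquivalent A B) :
    FunctionallyEquivalent B A := fun O _ I L => (h O I L).symm

theorem FunctionallyEquivalent.trans {A B C : Algorithm m} (h : FunctionallyEquivalent A B)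
    (h' : FunctionallyEquivalent B C) : FunctionallyEquivalent A C :=
  fun O _ I L => (h O I L).trans (h' O I L)

theorem FunctionallyEquivalent.hasNthOutput {A B : Algorithm m}
    (h : FunctionallyEquivalent A B) {p : ℕ} (hp : A.HasNthOutput I p) : B.HasNthOutput I p := by
  obtain ⟨hp, L, hL, hle⟩ := hp
  exact ⟨hp, L, (h O I L).1 hL, hle⟩

theorem FunctionallyEquivalent.exists_emit {A B : Algorithm m}
    (h : FunctionallyEquivalent A B) {p : ℕ} (hp : A.HasNthOutput I p) :
    ∃ n n' c, (A.act (A.history I n) = .emit c ∧ (outputs (A.history I n)).length + 1 = p) ∧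
      B.act (B.history I n') = .emit c ∧ (outputs (B.history I n')).length + 1 = p := by
  obtain ⟨n, c, hn, hlen⟩ := hp.exists_emit
  obtain ⟨n', c', hn', hlen'⟩ := (h.hasNthOutput hp).exists_emit
  obtain ⟨-, L, hL, -⟩ := hp
  have h1 := hL.getElem?_of_emit hn
  have h2 := ((h O I L).1 hL).getElem?_of_emit hn'
  rw [show (outputs (B.history I n')).length = (outputs (A.history I n)).length by omega, h1] at h2
  obtain rfl := Option.some.inj h2
  exact ⟨n, n', c, ⟨hn, hlen⟩, hn', hlen'⟩

variable {tie : TieRule m} {B : Algorithm m}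

theorem minimal_of_emit (hm : 1 ≤ m) (hB : FunctionallyEquivalent (andAlgorithm tie) B) {n : ℕ}
    {c : NonemptyInterval O} (h : B.act (B.history I n) = .emit c) : Minimal (Covers I) c := by
  obtain ⟨L, hL, -, hmem⟩ := exists_hasOutput tie hm I
  exact (hmem c).1 (List.mem_of_getElem? (((hB O I L).1 hL).getElem?_of_emit h))

/-- An algorithm for AND that returns `c` has read from each list an interval contained in `c`. -/
theorem exists_read_le (hm : 1 ≤ m) (hB : FunctionallyEquivalent (andAlgorithm tie) B) {n : ℕ}
    {c : NonemptyInterval O} (h : B.act (B.history I n) = .emit c) (i : Fin m) :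
    ∃ k x, k < reads i (B.history I n) ∧ (I.list i)[k]? = some x ∧ x ≤ c := by
  classical
  by_contra! hne
  obtain ⟨x, hx, hxc⟩ := (minimal_of_emit hm hB h).1 i
  obtain ⟨k, hk⟩ := List.mem_iff_getElem?.1 hx
  have hrk : reads i (B.history I n) ≤ k := by
    by_contra hlt
    exact hne k x (not_le.1 hlt) hk hxc
  have hkl := (List.getElem?_eq_some_iff.1 hk).1
  let f : O ↪o WithTop O := WithTop.coeOrderHom
  -- The unread part of list `i` is replaced by `[⊤..⊤]`, which is not contained in `c`; then no
  -- element of that list is.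
  let l : Fin m → List (NonemptyInterval (WithTop O)) := fun j =>
    if j = i then ((I.list j).take (reads j (B.history I n))).map (mapInterval f) ++
      [NonemptyInterval.pure ⊤] else (I.list j).map (mapInterval f)
  have hl (j) : ValidList (l j) := by
    simp only [l]
    split_ifs
    · exact (I.validList j).take_append f _ _
        fun a _ y _ => ⟨WithTop.coe_lt_top _, WithTop.coe_lt_top _⟩
    · exact (I.validList j).map f
  have hist := B.history_map_of_agree f I (Input.ofValid l hl) n fun j a ha => by
    show (l j)[a]? = _
    simp only [l]
    split_ifs with hj
    · subst hj
      exact getElem?_take_append f _ ha (by omega)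
    · exact List.getElem?_map
  have hact : B.act (B.history (Input.ofValid l hl) n) = .emit (mapInterval f c) := by
    rw [hist, B.act_map, h]
    rfl
  obtain ⟨z, hz, hzc⟩ := (minimal_of_emit hm hB hact).1 i
  change z ∈ l i at hz
  simp only [l, if_true, List.mem_append, List.mem_map, List.mem_singleton] at hz
  rcases hz with ⟨y, hy, rfl⟩ | rfl
  · obtain ⟨a, ha⟩ := List.mem_iff_getElem?.1 hy
    rw [List.getElem?_take] at ha
    split_ifs at ha with har
    exact hne a y har ha ((mapInterval_le f).1 hzc)
  · exact (WithTop.coe_lt_top c.snd).not_ge (NonemptyInterval.le_def.1 hzc).2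

/-- The embedding of `O` in an order in which each element of `O` has an immediate successor. -/
def succEmbedding (O : Type) [LinearOrder O] : O ↪o O ×ₗ Bool :=
  OrderEmbedding.ofStrictMono (fun o => toLex (o, false)) fun _ _ h =>
    Prod.Lex.toLex_lt_toLex.2 (Or.inl h)

/-- An algorithm for AND that returns an interval `c` that does not belong to the lists has read an
interval with the same left extreme, and the element after it, which is not contained in `c`. -/
theorem exists_read_successor (hm : 1 ≤ m) (hB : FunctionallyEquivalent (andAlgorithm tie) B)
    {n : ℕ} {c : NonemptyInterval O} (h : B.act (B.history I n) = .emit c)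
    (hc : ∀ i, c ∉ I.list i) :
    ∃ j k x, k + 1 < reads j (B.history I n) ∧ (I.list j)[k]? = some x ∧ x.fst = c.fst ∧
      ∀ y, (I.list j)[k + 1]? = some y → c.snd < y.snd := by
  classical
  by_contra! hne
  choose k x hk hx hxc using exists_read_le hm hB h
  have hxc' := fun j => NonemptyInterval.le_def.1 (hxc j)
  have hxne (j) : x j ≠ c := fun he => hc j (he ▸ List.mem_of_getElem? (hx j))
  -- A one-point interval contains only itself, so it could not cover lists to which it does not
  -- belong.
  have hlt : c.fst < c.snd := by
    refine lt_of_le_of_ne c.fst_le_snd fun he => hxne ⟨0, hm⟩ ?_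
    have h1 := hxc' ⟨0, hm⟩
    have h2 := (x ⟨0, hm⟩).fst_le_snd
    exact NonemptyInterval.ext (Prod.ext (le_antisymm ((h2.trans h1.2).trans he.ge) h1.1)
      (le_antisymm h1.2 (he.ge.trans (h1.1.trans h2))))
  let f := succEmbedding O
  -- The lists that still have an element inside `c` when the left extreme of `c` is moved slightly
  -- to the right.
  let S : Fin m → Prop := fun j => ∃ y ∈ I.list j, y ≤ c ∧ c.fst < y.fst
  have hfst (j) (hj : ¬ S j) : (x j).fst = c.fst := by
    refine le_antisymm ?_ (hxc' j).1
    by_contra hlt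
    exact hj ⟨x j, List.mem_of_getElem? (hx j), hxc j, not_le.1 hlt⟩
  have hsnd (j) (hj : ¬ S j) : (x j).snd < c.snd :=
    lt_of_le_of_ne (hxc' j).2 fun he => hxne j (NonemptyInterval.ext (Prod.ext (hfst j hj) he))
  -- Outside `S`, reading has stopped at `x j`: its successor would lie inside `c` by `hne` and
  -- start later, putting `j` in `S`.
  have hr (j) (hj : ¬ S j) : reads j (B.history I n) ≤ k j + 1 := by
    by_contra hlt
    obtain ⟨y, hy, hyc⟩ := hne j (k j) (x j) (not_le.1 hlt) (hx j) (hfst j hj)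
    have hxy := ((I.validList j).getElem?_lt (hx j) hy (Nat.lt_succ_self _)).1
    rw [hfst j hj] at hxy
    exact hj ⟨y, List.mem_of_getElem? hy, NonemptyInterval.le_def.2 ⟨hxy.le, hyc⟩, hxy⟩
  -- The interval `c` with its left extreme moved to its immediate successor. Appended after `x j`
  -- to the lists outside `S`, it makes `d` covering, so that `c` is no longer minimal.
  let d : NonemptyInterval (O ×ₗ Bool) :=
    ⟨(toLex (c.fst, true), toLex (c.snd, false)), Prod.Lex.toLex_le_toLex.2 (Or.inl hlt)⟩
  let l : Fin m → List (NonemptyInterval (O ×ₗ Bool)) := fun j =>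
    if S j then (I.list j).map (mapInterval f)
    else ((I.list j).take (k j + 1)).map (mapInterval f) ++ [d]
  have hl (j) : ValidList (l j) := by
    simp only [l]
    split_ifs with hj
    · exact (I.validList j).map f
    · refine (I.validList j).take_append f _ _ fun a ha y hy => ?_
      have hyx := (I.validList j).getElem?_le hy (hx j) (Nat.lt_succ_iff.1 ha)
      rw [hfst j hj] at hyx
      refine ⟨Prod.Lex.toLex_lt_toLex.2 ?_,
        Prod.Lex.toLex_lt_toLex.2 (Or.inl (hyx.2.trans_lt (hsnd j hj)))⟩
      rcases hyx.1.lt_or_eq with h1 | h1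
      · exact Or.inl h1
      · exact Or.inr ⟨h1, Bool.false_lt_true⟩
  have hist := B.history_map_of_agree f I (Input.ofValid l hl) n fun j a ha => by
    show (l j)[a]? = _
    simp only [l]
    split_ifs with hj
    · exact List.getElem?_map
    · have := (List.getElem?_eq_some_iff.1 (hx j)).1
      exact getElem?_take_append f _ (ha.trans_le (hr j hj)) this
  have hact : B.act (B.history (Input.ofValid l hl) n) = .emit (mapInterval f c) := by
    rw [hist, B.act_map, h]
    rfl
  have hcov : Covers (Input.ofValid l hl) d := fun j => by
    show ∃ z ∈ l j, z ≤ d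
    simp only [l]
    split_ifs with hj
    · obtain ⟨y, hy, hyc, hlt⟩ := hj
      exact ⟨_, List.mem_map_of_mem hy, NonemptyInterval.le_def.2
        ⟨Prod.Lex.toLex_le_toLex.2 (Or.inl hlt),
          f.monotone (NonemptyInterval.le_def.1 hyc).2⟩⟩
    · exact ⟨d, by simp, le_rfl⟩
  have hdc : d ≤ mapInterval f c := NonemptyInterval.le_def.2
    ⟨Prod.Lex.toLex_le_toLex.2 (Or.inr ⟨rfl, Bool.false_le _⟩), le_rfl⟩
  have := (NonemptyInterval.le_def.1 ((minimal_of_emit hm hB hact).2 hcov hdc)).1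
  rcases Prod.Lex.toLex_le_toLex.1 this with h1 | ⟨-, h1⟩
  · exact lt_irrefl _ h1
  · exact absurd (show true ≤ false from h1) (by decide)

end LowerBounds

/-! ### Laziness of the algorithm for AND -/

section Main

variable {m : ℕ}

/-- If the queue were ahead by two, it would have passed the successor of the element `x` inside `c`
read by `B`; that successor starts after `x`, hence after `c`, which the invariant forbids. -/
theorem isLazy_one (hm : 1 ≤ m) (tie : TieRule m) : IsLazy 1 (andAlgorithm tie) := by
  intro B hB O _ I i p hp
  obtain ⟨n, n', c, ⟨hn, hlen⟩, hn', hlen'⟩ := hB.exists_emit hp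
  rw [Algorithm.rho_of_emit hn hlen, Algorithm.rho_of_emit hn' hlen']
  obtain ⟨hc, -⟩ := candidate_of_emit tie hm hn
  obtain ⟨k, x, hk, hx, hxc⟩ := exists_read_le hm hB hn' i
  by_contra hlt
  have hle := reads_history_le tie hm I n i
  have hy := List.getElem?_eq_getElem (l := I.list i) (i := k + 1) (by omega)
  have h1 := ((I.validList i).getElem?_lt hx hy (Nat.lt_succ_self k)).1
  exact h1.not_ge ((hc.passed i _ ⟨k + 1, by omega, hy⟩).trans (NonemptyInterval.le_def.1 hxc).1)

/-- If null is read while `x` is being shrunk, then `x` is returned. -/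
theorem act_append_read_none {O : Type} [LinearOrder O] (tie : TieRule m)
    {h : List (Event m O)} (hh : m ≤ h.length) {x : NonemptyInterval O}
    (hctl : (State.after h).control =
      ({ State.after h with c := some x, loop := .second }, .advance)) (i : Fin m) :
    (andAlgorithm tie).act (h ++ [.read i none]) = .emit x := by
  rw [andAct_of_le tie (by simp; omega), State.after_append hh, hctl]
  have hf : ¬ (State.receive { State.after h with c := some x, loop := .second }
      (.read i none)).Full := fun hf => by simpa [State.receive] using hf i
  have hctl' : (State.receive { State.after h with c := some x, loop := .second }
      (.read i none)).control.2 = .ret x := by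
    rw [State.control]
    simp only [hf, false_and, if_false]
    simp [State.receive]
  simp only [hctl']

/-- If `B` saves a read on list `i`, it pays with a read on another list `j`. Cutting list `i` just
before the read that `B` saves exposes this: the queue returns `c` at once, while `B`, which sees no
difference, has already read more of list `j`. -/
theorem minimallyLazy (hm : 1 ≤ m) (tie : TieRule m) : MinimallyLazy (andAlgorithm tie) := by
  classical
  intro B hB hle O _ I i p hp
  refine le_antisymm (hle O I i p hp) ?_
  obtain ⟨n, n', c, ⟨hn, hlen⟩, hn', hlen'⟩ := hB.exists_emit hp
  rw [Algorithm.rho_of_emit hn hlen, Algorithm.rho_of_emit hn' hlen']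
  by_contra! hlt
  obtain ⟨hc, hmin⟩ := candidate_of_emit tie hm hn
  obtain ⟨k, x, hk, hx, hxc⟩ := exists_read_le hm hB hn' i
  rw [NonemptyInterval.le_def] at hxc
  have hnot (j) : c ∉ I.list j := fun hj =>
    (hc.top j hj i x ⟨k, by omega, hx⟩).not_ge hxc.1
  obtain ⟨j, k', z, hk', hz, hzc, hnext⟩ := exists_read_successor hm hB hn' hnot
  -- Index `q + 1` is that of the last read of the queue on list `i`, possibly null; `y`, at index
  -- `q`, is the last element passed there.
  obtain ⟨q, hq⟩ : ∃ q, reads i ((andAlgorithm tie).history I n) = q + 2 :=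
    ⟨_, (Nat.sub_add_cancel (by omega)).symm⟩
  have hyl : q < (I.list i).length := by
    have := reads_history_le tie hm I n i
    omega
  have hy := List.getElem?_eq_getElem hyl
  set y := (I.list i)[q]
  have hyc : y.fst = c.fst := le_antisymm (hc.passed i y ⟨q, by omega, hy⟩)
    (hxc.1.trans ((I.validList i).getElem?_le hx hy (by omega)).1)
  have hij : i ≠ j := by
    rintro rfl
    have := ((I.validList i).getElem?_lt hz hy (by omega)).1
    rw [hzc, hyc] at this
    exact lt_irrefl _ this
  -- the step in which the last element is read from the `i`-th list
  obtain ⟨n₁, hn₁, hr₁, hact₁⟩ := Algorithm.exists_read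
    (show q + 1 < reads i ((andAlgorithm tie).history I n) by omega)
  have hmn := le_of_reads_pos tie (by omega) hact₁
  have hlen₁ := le_length_history tie I hmn
  obtain ⟨hs, hinv⟩ := inv_history tie hm I hmn
  have hact := andAct_of_le tie hlen₁
  rw [hact₁] at hact
  have hcov : Covers I c := hmin.1
  -- The item replaced at this step is `y`, which starts with `c`, so the span does too. A sweep
  -- would mean that `c` had already been returned; a shrink has a candidate with the left extreme
  -- of `c`, which by minimality is `c`.
  have key : (State.after ((andAlgorithm tie).history I n₁)).control =
      ({ State.after ((andAlgorithm tie).history I n₁) with c := some c, loop := .second },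
        .advance) ∧ (State.after ((andAlgorithm tie).history I n₁)).Full ∧
      (State.after ((andAlgorithm tie).history I n₁)).SpanIs c := by
    have hfst (hf : (State.after ((andAlgorithm tie).history I n₁)).Full) (x)
        (hx : (State.after ((andAlgorithm tie).history I n₁)).SpanIs x)
        (hi : i = tie.choose ((andAlgorithm tie).history I n₁)
          (State.after ((andAlgorithm tie).history I n₁)).topIndices) : x.fst = c.fst := by
      obtain ⟨w, hw⟩ := State.exists_isTop_of_mem_topIndices
        (tie.choose_mem ((andAlgorithm tie).history I n₁) _ (State.topIndices_nonempty hm hf))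
      rw [← hi] at hw
      have hwy := (hs.ref_eq i).symm.trans hw.1
      rw [hr₁, Nat.add_sub_cancel, hy] at hwy
      rw [← hx.fst_eq_of_isTop hw, ← Option.some.inj hwy, hyc]
    rcases hinv.outcome hm hs with ⟨c₀, x, hctl, hl, hc₀, hf, hx, hxc, hp, ha, he⟩ |
      ⟨x, hctl, hf, hx, hp, hn⟩ | ⟨x, hctl, hp, hmin⟩ | ⟨hctl, he⟩
    · simp only [hctl, Action.read.injEq] at hact
      have hmem := (he.mem_iff c).2 ⟨hmin, (hfst hf x hx hact).ge.trans hxc⟩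
      have := ((hc.emitted.mem_iff c).1
        (((andAlgorithm tie).outputs_prefix I hn₁.le).subset hmem)).2
      exact absurd this (lt_irrefl _)
    · simp only [hctl, Action.read.injEq] at hact
      have hxf := hfst hf x hx hact
      have hxc : x ≤ c := NonemptyInterval.le_def.2 ⟨hxf.ge, hp.bound c hcov hxf.le⟩
      obtain rfl := le_antisymm hxc (hmin.2 hp.covers hxc)
      exact ⟨hctl, hf, hx⟩
    · simp [hctl] at hact
    · simp [hctl] at hact
  obtain ⟨hctl, hf, hspan⟩ := key
  -- The successor of `z` ends after `c`, so neither it nor anything later can be in a queue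
  -- spanning `c`.
  have hrj : reads j ((andAlgorithm tie).history I n₁) ≤ k' + 1 := by
    by_contra! hlt
    obtain ⟨w, hw⟩ := Option.isSome_iff_exists.1 (hf j)
    have hw' := (hs.ref_eq j).symm.trans hw
    have hwl := (List.getElem?_eq_some_iff.1 hw').1
    have hv := List.getElem?_eq_getElem (l := I.list j) (i := k' + 1) (by omega)
    exact (hnext _ hv).not_ge (((I.validList j).getElem?_le hv hw' (by omega)).2.trans
      (NonemptyInterval.le_def.1 (hspan.le j w hw)).2)
  -- the input in which null is read instead
  let l : Fin m → List (NonemptyInterval O) := fun a =>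
    if a = i then (I.list a).take (q + 1) else I.list a
  have hl (a) : ValidList (l a) := by
    simp only [l]
    split_ifs
    · exact (I.validList a).take (Nat.succ_pos q)
    · exact I.validList a
  let J := Input.ofValid l hl
  have hagree (C : Algorithm m) (t : ℕ) (ht : reads i (C.history I t) ≤ q + 1) :
      C.history J t = C.history I t := by
    refine C.history_eq_of_agree I J t fun a b hb => ?_
    show (l a)[b]? = _
    simp only [l]
    split_ifs with ha
    · subst ha
      rw [List.getElem?_take, if_pos (by omega)]
    · rfl
  have hA := hagree (andAlgorithm tie) n₁ hr₁.le
  have hBJ := hagree B n' (by omega)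
  have hA' : (andAlgorithm tie).history J (n₁ + 1) =
      (andAlgorithm tie).history I n₁ ++ [.read i none] := by
    rw [Algorithm.history_succ_of_read (by rw [hA, hact₁]), hA, hr₁]
    show _ ++ [Event.read i (l i)[q + 1]?] = _
    rw [List.getElem?_eq_none (by simp [l])]
  have hactA : (andAlgorithm tie).act ((andAlgorithm tie).history J (n₁ + 1)) = .emit c := by
    rw [hA']
    exact act_append_read_none tie hlen₁ hctl i
  have hactB : B.act (B.history J n') = .emit c := by rw [hBJ, hn']
  obtain ⟨L, hL, hLs, -⟩ := exists_hasOutput tie hm J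
  have hLA := hL.getElem?_of_emit hactA
  have hLB := ((hB O J L).1 hL).getElem?_of_emit hactB
  -- The output list has no duplicates, so both algorithms return `c` on `J` at the same position.
  have hpos : (outputs ((andAlgorithm tie).history J (n₁ + 1))).length =
      (outputs (B.history J n')).length := by
    obtain ⟨h1, h2⟩ := List.getElem?_eq_some_iff.1 hLA
    obtain ⟨h3, h4⟩ := List.getElem?_eq_some_iff.1 hLB
    have hnd : L.Nodup := hLs.imp fun h he => by rw [he] at h; exact lt_irrefl _ h
    exact (hnd.getElem_inj_iff).1 (h2.trans h4.symm)
  have hpJ : (andAlgorithm tie).HasNthOutput J p := by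
    refine ⟨hp.1, L, hL, ?_⟩
    have := (List.getElem?_eq_some_iff.1 hLB).1
    rw [hBJ] at this
    omega
  have := hle O J j p hpJ
  rw [Algorithm.rho_of_emit hactA (by rw [hpos, hBJ, hlen']),
    Algorithm.rho_of_emit hactB (by rw [hBJ, hlen']), hBJ, hA', reads_append_read,
    if_neg hij] at this
  omega

/-- If some algorithm equivalent to a minimally lazy one is 0-lazy, then so is the latter. -/
theorem MinimallyLazy.isLazy_zero {A B : Algorithm m} (hA : MinimallyLazy A)
    (hAB : FunctionallyEquivalent A B) (hB : IsLazy 0 B) : IsLazy 0 A := by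
  intro C hC O _ I i p hp
  rw [← hA B hAB (fun O _ I i p hp => by
    have := hB A hAB.symm O I i p (hAB.hasNthOutput hp)
    omega) O I i p hp]
  exact hB C (hAB.symm.trans hC) O I i p (hAB.hasNthOutput hp)

theorem validList_singleton {O : Type} [LinearOrder O] (x : NonemptyInterval O) :
    ValidList [x] := ⟨by simp, List.pairwise_singleton _ _⟩

theorem optimallyLazy (hm : 1 ≤ m) (tie : TieRule m) : OptimallyLazy (andAlgorithm tie) := by
  by_cases h0 : IsLazy 0 (andAlgorithm tie)
  · refine ⟨0, h0, ?_⟩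
    rintro ⟨B, hB, hlazy⟩
    -- Any input with an output serves: comparing `B` with itself rules out a negative constant.
    let x : NonemptyInterval ℕ := NonemptyInterval.pure 0
    let J : Input m ℕ := Input.ofValid (fun _ => [x]) fun _ => validList_singleton x
    obtain ⟨L, hL, -, hmem⟩ := exists_hasOutput tie hm J
    have hcov : Covers J x := fun i => ⟨x, List.mem_singleton_self x, le_rfl⟩
    have hx := (hmem x).2 (minimal_of_mem hcov (i := ⟨0, hm⟩) (List.mem_singleton_self x))
    have := hlazy B (fun _ _ _ _ => Iff.rfl) ℕ J ⟨0, hm⟩ 1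
      ⟨le_rfl, L, (hB ℕ J L).1 hL, List.length_pos_of_mem hx⟩
    omega
  · refine ⟨1, isLazy_one hm tie, ?_⟩
    rintro ⟨B, hB, hlazy⟩
    exact h0 ((minimallyLazy hm tie).isLazy_zero hB hlazy)

/-! ### Ties between three lists -/

/-- The rule that chooses `j` whenever possible. -/
def TieRule.prefer (tie : TieRule m) (j : Fin m) : TieRule m where
  choose h S := if j ∈ S then j else tie.choose h S
  choose_mem h S hS := by
    split_ifs with hj
    exacts [hj, tie.choose_mem h S hS]
  choose_map f h S := by rw [tie.choose_map]

/-- Two lists containing only `[0..0]`, and other lists containing only `[1..1]`. -/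
def tieInput (m : ℕ) : Input m ℕ :=
  Input.ofValid (fun i => [NonemptyInterval.pure (if i.1 < 2 then 0 else 1)])
    fun _ => validList_singleton _

/-- The lists holding `[1..1]` stretch the span to `[0..1]`, which is in no list, so the queue must
advance one of the two tied lists. It finds null there and returns, leaving the other tied list at
one read. -/
theorem rho_tieInput (hm : 3 ≤ m) (tie : TieRule m) :
    ∃ i : Fin m, i.1 < 2 ∧ (∀ j : Fin m, j.1 < 2 → ∀ tie' : TieRule m, tie = tie'.prefer j →
      i = j) ∧ (andAlgorithm tie).HasNthOutput (tieInput m) 1 ∧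
      ∀ j, (andAlgorithm tie).rho (tieInput m) j 1 = if i = j then 2 else 1 := by
  have hm1 : 1 ≤ m := by omega
  set h := (andAlgorithm tie).history (tieInput m) m with hh
  obtain ⟨-, hout, hr, -⟩ := history_initial tie (tieInput m) le_rfl
  have hlen := le_length_history tie (tieInput m) le_rfl
  have hafter : State.after h = { ref := fun i => some (NonemptyInterval.pure
      (if i.1 < 2 then 0 else 1)), c := none, loop := .first } :=
    after_initial tie (tieInput m)
  have hf : (State.after h).Full := fun i => by rw [hafter]; rfl
  obtain ⟨x, hx⟩ := State.exists_spanIs hm1 hf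
  have href (i : Fin m) : (State.after h).ref i =
      some (NonemptyInterval.pure (if i.1 < 2 then 0 else 1)) := by rw [hafter]
  have h0 := (NonemptyInterval.le_def.1 (hx.le ⟨0, by omega⟩ _ (href _))).1
  have h2 := (NonemptyInterval.le_def.1 (hx.le ⟨2, by omega⟩ _ (href _))).2
  change x.fst ≤ 0 at h0
  change 1 ≤ x.snd at h2
  have hctl : (State.after h).control =
      ({ State.after h with c := some x, loop := .second }, .advance) := by
    have hloop : (State.after h).loop = .first := by rw [hafter]
    have hcle : ¬ (State.after h).CLeSpan := by simp [State.CLeSpan, hafter]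
    simp only [State.control, hloop, hcle, and_false, if_false, hf, if_true]
    rw [hx.body_eq, if_neg]
    rintro ⟨i, hi⟩
    rw [href, Option.some.injEq] at hi
    have : x.fst = x.snd := by rw [← hi]; rfl
    omega
  have htop (j : Fin m) (hj : j.1 < 2) : j ∈ (State.after h).topIndices := by
    simp only [State.topIndices, Finset.mem_filter, Finset.mem_univ, true_and]
    refine ⟨_, href j, href j, fun a y hy => ?_⟩
    rw [href, Option.mem_def, Option.some.injEq] at hy
    subst hy
    simp only [Prec, NonemptyInterval.pure, hj, if_true]
    split_ifs <;> simp
  have hact := andAct_of_le tie hlen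
  rw [← hh, hctl] at hact
  set i := tie.choose h (State.after h).topIndices with hi
  have hi2 : i.1 < 2 := by
    obtain ⟨y, hy⟩ := State.exists_isTop_of_mem_topIndices
      (tie.choose_mem h _ (State.topIndices_nonempty hm1 hf))
    have hfst := hx.fst_eq_of_isTop hy
    have hyi := hy.1
    rw [href, Option.some.injEq] at hyi
    by_contra hge
    have : y.fst = 1 := by rw [← hyi, if_neg hge]; rfl
    omega
  have hr' : ∀ i, reads i h = 1 := by simp [hh, hr]
  have hsucc : (andAlgorithm tie).history (tieInput m) (m + 1) = h ++ [.read i none] := by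
    rw [Algorithm.history_succ_of_read hact, ← hh, hr']
    rfl
  have hemit : (andAlgorithm tie).act ((andAlgorithm tie).history (tieInput m) (m + 1)) =
      .emit x := by
    rw [hsucc]
    exact act_append_read_none tie hlen hctl i
  have hout' : (outputs ((andAlgorithm tie).history (tieInput m) (m + 1))).length = 0 := by
    rw [hsucc, outputs_append_read, hout]
    rfl
  refine ⟨i, hi2, ?_, ?_, fun j => ?_⟩
  · rintro j hj tie' rfl
    exact if_pos (htop j hj)
  · obtain ⟨L, hL, -⟩ := exists_hasOutput tie hm1 (tieInput m)
    have := hL.getElem?_of_emit hemit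
    rw [hout'] at this
    exact ⟨le_rfl, L, hL, (List.getElem?_eq_some_iff.1 this).1⟩
  · rw [Algorithm.rho_of_emit hemit (by rw [hout']), hsucc, reads_append_read, hr']
    split_ifs <;> rfl

theorem not_isLazy_zero (hm : 3 ≤ m) (tie : TieRule m) : ¬ IsLazy 0 (andAlgorithm tie) := by
  intro h0
  obtain ⟨i, hi, -, hout, hrho⟩ := rho_tieInput hm tie
  -- The other of the two tied lists, so that the competing rule saves a read on list `i`.
  let j : Fin m := ⟨1 - i.1, by omega⟩
  have hij : i ≠ j := fun he => by
    have := congrArg Fin.val he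
    simp only [j] at this
    omega
  obtain ⟨i', -, hi', -, hrho'⟩ := rho_tieInput hm (tie.prefer j)
  have hj : i' = j := hi' j (show 1 - i.1 < 2 by omega) tie rfl
  have := h0 _ (functionallyEquivalent_of_tieRule tie (by omega) (tie.prefer j)) ℕ (tieInput m) i 1
    hout
  rw [hrho, hrho', hj, if_pos rfl, if_neg hij.symm] at this
  norm_num at this

end Main
end LazyAnd

theorem mainTheorem1 (m : ℕ) (hm : 1 ≤ m) (tie : LazyAnd.TieRule m) :
    LazyAnd.MinimallyLazy (LazyAnd.andAlgorithm tie) ∧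
    LazyAnd.OptimallyLazy (LazyAnd.andAlgorithm tie) ∧
    LazyAnd.IsLazy 1 (LazyAnd.andAlgorithm tie) ∧
    (3 ≤ m → ¬ ∃ B : LazyAnd.Algorithm m,
      LazyAnd.FunctionallyEquivalent (LazyAnd.andAlgorithm tie) B ∧ LazyAnd.IsLazy 0 B) := by
  refine ⟨LazyAnd.minimallyLazy hm tie, LazyAnd.optimallyLazy hm tie, LazyAnd.isLazy_one hm tie, ?_⟩
  rintro h3 ⟨B, hB, h0⟩
  exact LazyAnd.not_isLazy_zero h3 tie ((LazyAnd.minimallyLazy hm tie).isLazy_zero hB h0)
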